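/- **Setting.** Let $n,d,b\ge 0$ be integers and let $H$ be a Hermitian $2^n\times 2^n$ matrix (a Hamiltonian on $n$ qubits, written in the computational basis $|0\rangle,\dots,|2^n-1\rangle$) that is $d$-sparse, i.e. has at most $d$ nonzero entries in any row or column; put $\|H\|_{\max}=\max_{j,k}|H_{jk}|$. The Hamiltonian is given by two oracles: * $O_F|j,\ell\rangle=|j,f(j,\ell)\rangle$, where every $f(j,\cdot)$ is a permutation of $\{0,\dots,2^n-1\}$ and every column $k$ with $H_{jk}\ne0$ equals $f(j,\ell)$ for some $\ell\in\{0,\dots,d-1\}$ (a row with fewer than $d$ nonzero entries is padded with arbitrary further columns); * $O_H|j,k,z\rangle=|j,k,z\oplus h(j,k)\rangle$ on $b$-bit strings $z$, where the bit string $h(j,k)$ represents the entry $H_{jk}$ under a fixed known encoding $\mathrm{dec}:\{0,1\}^b\to\mathbb C$, i.e. $\mathrm{dec}(h(j,k))=H_{jk}$. A *quantum query algorithm* starts with the $n$-qubit input $|\psi\rangle$ in the first oracle register and with the other oracle registers and a finite-dimensional workspace in fixed basis states, and applies a finite sequence of operations, each of which is either a unitary independent of the oracles or one use of $O_F$, $O_F^{\dagger}$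 or $O_H$ on the oracle registers; its number of queries is the number of operations of the latter kind. It *simulates $H$ for time $t$ within error $\epsilon$* if the map that it induces on inputs, $|\psi\rangle\mapsto A\,|\psi\rangle|0\rangle$, is within $\epsilon$ in spectral norm of $|\psi\rangle\mapsto(e^{-iHt}|\psi\rangle)|0\rangle$, where $|0\rangle$ is the initial state of everything but the input register. **Theorem.** A $d$-sparse Hamiltonian $H$ on $n$ qubits, given by the oracles $O_F$ and $O_H$, can be simulated for time $t\ge0$ within error $\epsilon>0$ with $$O\!\left(\tau\,\frac{\log\log\tau}{\log\log\log\tau}+\log(1/\epsilon)\right)$$ queries, where $\tau:=t\,\|H\|_{\max}\,d$. That is, there is an absolute constant $C$ such that for all $n$, $d$, $b$, $\mathrm{dec}$, $\Lambda\ge0$, $t\ge0$ and $\epsilon>0$ there is a quantum query algorithm, depending only on these data, that makes at most $$C\left(\tau\, g(\tau)+\max\{\log(1/\epsilon),0\}\right),\qquad \tau=t\Lambda d,$$ queries and that simulates, for time $t$ and within error $\epsilon$, every $d$-sparse Hamiltonian $H$ on $n$ qubits with $\|H\|_{\max}=\Lambda$ when it is run with any oracles $O_F,O_H$ for $H$ as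 above. Here $g(\tau)=\log\log\tau/\log\log\log\tau$ for $\tau>e^e$, and $g(\tau)=1$ for $\tau\le e^e$, where that quotient is undefined or not positive. -/

import Mathlib

noncomputable section

/-- Computational basis labels of `n` qubits. -/
abbrev QIndex (n : ℕ) : Type := Fin (2 ^ n)

/-- Bit strings of length `b`. -/
abbrev BitString (b : ℕ) : Type := Fin b → Bool

/-- `H` has at most `d` nonzero entries in any row or column. -/
def IsSparse {n : ℕ} (d : ℕ) (H : Matrix (QIndex n) (QIndex n) ℂ) : Prop :=
  (∀ j, Set.ncard {k | H j k ≠ 0} ≤ d) ∧ (∀ k, Set.ncard {j | H j k ≠ 0} ≤ d)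

/-- The max-norm, i.e. the largest modulus of an entry. -/
def maxNorm {n : ℕ} (H : Matrix (QIndex n) (QIndex n) ℂ) : ℝ :=
  ⨆ p : QIndex n × QIndex n, ‖H p.1 p.2‖

/-- The exact evolution operator `exp(-iHt)`. -/
def evolution {n : ℕ} (H : Matrix (QIndex n) (QIndex n) ℂ) (t : ℝ) :
    Matrix (QIndex n) (QIndex n) ℂ :=
  NormedSpace.exp ((-(Complex.I * (t : ℂ))) • H)

open scoped Matrix.Norms.L2Operator in
/-- The spectral norm, i.e. the operator norm for the Euclidean norms. -/
def matrixSpectralNorm {ι κ : Type} [Fintype ι] [Fintype κ] [DecidableEq κ]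
    (A : Matrix ι κ ℂ) : ℝ :=
  ‖A‖

/-- `f` gives the positions of the nonzero entries of `H`. The oracle computes `f j ℓ` in place, so
`f j` is a permutation of the labels. Indices `ℓ` are counted from zero: the columns of the nonzero
entries of row `j` are among `f j 0, …, f j (d - 1)`. A row with fewer than `d` nonzero entries is
padded by arbitrary further columns, and the values of `f j` at `ℓ ≥ d` are arbitrary. -/
def IsPositionOracle {n : ℕ} (d : ℕ) (H : Matrix (QIndex n) (QIndex n) ℂ)
    (f : QIndex n → Equiv.Perm (QIndex n)) : Prop :=
  ∀ j k, H j k ≠ 0 → ∃ ℓ : QIndex n, (ℓ : ℕ) < d ∧ f j ℓ = k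

/-- `h j k` is a bit string that represents the entry `H j k`, where `dec` says which complex number
a bit string represents. -/
def IsValueOracle {n b : ℕ} (dec : BitString b → ℂ) (H : Matrix (QIndex n) (QIndex n) ℂ)
    (h : QIndex n → QIndex n → BitString b) : Prop :=
  ∀ j k, dec (h j k) = H j k

/-- Basis of the full Hilbert space of an algorithm: the two `n`-qubit registers and the `b`-qubit
register that oracles act on, and a workspace with basis `Anc`. -/
abbrev FullBasis (n b : ℕ) (Anc : Type) : Type :=
  QIndex n × QIndex n × BitString b × Anc

/-- One step of an algorithm: a unitary that does not depend on the oracles, or one query to `O_F`,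
to the inverse of `O_F`, or to `O_H` (which is its own inverse). -/
inductive Step (n b : ℕ) (Anc : Type) [Fintype Anc] [DecidableEq Anc] : Type
  | gate (U : Matrix.unitaryGroup (FullBasis n b Anc) ℂ) : Step n b Anc
  | queryF : Step n b Anc
  | queryFInv : Step n b Anc
  | queryH : Step n b Anc

/-- The linear operator that sends the basis vector `|y⟩` to `|σ y⟩`. -/
def basisMap {ι : Type} [DecidableEq ι] (σ : ι → ι) : Matrix ι ι ℂ :=
  Matrix.of fun x y => if x = σ y then 1 else 0

/-- The operator applied by one step, for the oracles
`O_F |j, ℓ⟩ = |j, f j ℓ⟩` and `O_H |j, k, z⟩ = |j, k, z ⊕ h j k⟩`. -/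
def Step.toMatrix {n b : ℕ} {Anc : Type} [Fintype Anc] [DecidableEq Anc]
    (f : QIndex n → Equiv.Perm (QIndex n)) (h : QIndex n → QIndex n → BitString b) :
    Step n b Anc → Matrix (FullBasis n b Anc) (FullBasis n b Anc) ℂ
  | .gate U => U.1
  | .queryF => basisMap fun (j, l, z, a) => (j, f j l, z, a)
  | .queryFInv => basisMap fun (j, k, z, a) => (j, (f j).symm k, z, a)
  | .queryH => basisMap fun (j, k, z, a) => (j, k, fun i => xor (z i) (h j k i), a)

/-- The number of queries made by one step. -/
def Step.queries {n b : ℕ} {Anc : Type} [Fintype Anc] [DecidableEq Anc] : Step n b Anc → ℕ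
  | .gate _ => 0
  | .queryF => 1
  | .queryFInv => 1
  | .queryH => 1

/-- A quantum query algorithm: a finite-dimensional workspace with a basis state in which it starts,
and a finite sequence of steps, the head of the list being applied first. -/
structure QueryAlgorithm (n b : ℕ) where
  Anc : Type
  [fintypeAnc : Fintype Anc]
  [decidableEqAnc : DecidableEq Anc]
  start : Anc
  steps : List (Step n b Anc)

attribute [instance] QueryAlgorithm.fintypeAnc QueryAlgorithm.decidableEqAnc

/-- The total number of queries. -/
def QueryAlgorithm.queryCount {n b : ℕ} (A : QueryAlgorithm n b) : ℕ :=
  (A.steps.map Step.queries).sum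

/-- The operator applied by the whole algorithm. -/
def QueryAlgorithm.toMatrix {n b : ℕ} (A : QueryAlgorithm n b)
    (f : QIndex n → Equiv.Perm (QIndex n)) (h : QIndex n → QIndex n → BitString b) :
    Matrix (FullBasis n b A.Anc) (FullBasis n b A.Anc) ℂ :=
  A.steps.foldl (fun M s => s.toMatrix f h * M) 1

/-- The isometry `|ψ⟩ ↦ |ψ⟩|0⟩|0⟩|start⟩` that places an `n`-qubit state in the first register and
initialises everything else. -/
def QueryAlgorithm.embed {n b : ℕ} (A : QueryAlgorithm n b) :
    Matrix (FullBasis n b A.Anc) (QIndex n) ℂ :=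
  Matrix.of fun x j => if x = (j, 0, fun _ => false, A.start) then 1 else 0

/-- With oracles `f`, `h`, the algorithm performs the operator `V` on `n` qubits within error `ε`:
the map `|ψ⟩ ↦ A |ψ⟩|0⟩` is within `ε` of `|ψ⟩ ↦ (V |ψ⟩)|0⟩` in spectral norm. -/
def QueryAlgorithm.Implements {n b : ℕ} (A : QueryAlgorithm n b)
    (f : QIndex n → Equiv.Perm (QIndex n)) (h : QIndex n → QIndex n → BitString b)
    (V : Matrix (QIndex n) (QIndex n) ℂ) (ε : ℝ) : Prop :=
  matrixSpectralNorm (A.toMatrix f h * A.embed - A.embed * V) ≤ ε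

/-- `τ · log log τ / log log log τ + log (1/ε)`. The quotient is meaningful and positive exactly for
`τ > e^e`; for smaller `τ` it is replaced by `1`. The term `log (1/ε)` is read as `0` for `ε ≥ 1`. -/
def queryBound (τ ε : ℝ) : ℝ :=
  τ * (if Real.exp (Real.exp 1) < τ then
      Real.log (Real.log τ) / Real.log (Real.log (Real.log τ)) else 1)
    + max (Real.log (1 / ε)) 0

end

set_option linter.unusedSectionVars false

/-! ### Laurent polynomials on the unit circle: the truncated exponential of the cosine -/

noncomputable section

open Polynomial


/-! The proof gives the stronger bound `O(τ + log (1/ε))`; the quotient of iterated logarithms is at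
least one, so the stated bound follows (`add_max_log_le_queryBound`).

Two uses of the position oracle (`O_F` and its inverse) and two of the value oracle build a unitary
`U` that block-encodes `X = H / (Λ N)`, where `N ≤ d` is the number of labels below `d`: with `G`
the isometry that adds the ancillas, `Gᴴ U G = X`. On the range of `G` the unitary `U` agrees with
its adjoint. Multiplying by the reflection about that range gives a quantum walk `W` whose cosine
`(W + Wᴴ) / 2` intertwines `G` with `X`. Hence the Taylor polynomial of `exp (a cos)`, with `a = -i
t Λ N`, acts through `G` as the Taylor polynomial of `exp (-iHt)` (`aeval_expCos_mul`).

A function of `W` of this kind can be applied coherently. Multiplied by `W ^ M`, the Taylor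
polynomial of degree `M` in the cosine becomes an ordinary polynomial in `W` of degree `2 M`. On the
unit circle it is nearly unimodular, because `a` is imaginary. After division by a factor close to
one, its autocorrelations are small enough for an explicit sum-of-squares completion to a vector
polynomial of unit norm (`exists_unit_completion`). Such a vector polynomial is peeled off degree by
degree, each degree costing one controlled `W` and one rotation of the index
(`exists_realizes_vector_polynomial`). Applying the inverse of `W ^ M` removes the extra power.

The desired component is nearly isometric, so nothing significant leaks into the others and no
amplitude amplification is needed: two isometries are close once their overlap is close to the
identity (`l2_opNorm_sub_sq_le_of_isometry`). An error `δ` in the block becomes one of order `√δ`,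
which only changes the constant of `log (1/ε)`. Since `δ = 2⁻ᴹ exp (4 τ)` is available, `M` of order
`τ + log (1/ε)` suffices. -/

/-- The sum of the moduli of the coefficients of a polynomial. -/
def coeffNorm (p : ℂ[X]) : ℝ := ∑' j, ‖p.coeff j‖

theorem summable_norm_coeff (p : ℂ[X]) : Summable fun j => ‖p.coeff j‖ := by
  refine summable_of_ne_finset_zero (s := p.support) fun j hj => ?_
  simpa using hj

theorem coeffNorm_nonneg (p : ℂ[X]) : 0 ≤ coeffNorm p := tsum_nonneg fun _ => norm_nonneg _

theorem sum_norm_coeff_le_coeffNorm (p : ℂ[X]) (s : Finset ℕ) :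
    ∑ j ∈ s, ‖p.coeff j‖ ≤ coeffNorm p :=
  (summable_norm_coeff p).sum_le_tsum s fun _ _ => norm_nonneg _

theorem coeffNorm_add_le (p q : ℂ[X]) : coeffNorm (p + q) ≤ coeffNorm p + coeffNorm q := by
  unfold coeffNorm
  rw [← (summable_norm_coeff p).tsum_add (summable_norm_coeff q)]
  refine (summable_norm_coeff _).tsum_le_tsum (fun j => ?_)
    ((summable_norm_coeff p).add (summable_norm_coeff q))
  rw [coeff_add]
  exact norm_add_le _ _

theorem coeffNorm_mul_le (p q : ℂ[X]) : coeffNorm (p * q) ≤ coeffNorm p * coeffNorm q := by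
  have hp : Summable fun j => ‖(‖p.coeff j‖)‖ := by simpa using summable_norm_coeff p
  have hq : Summable fun j => ‖(‖q.coeff j‖)‖ := by simpa using summable_norm_coeff q
  unfold coeffNorm
  rw [tsum_mul_tsum_eq_tsum_sum_antidiagonal_of_summable_norm hp hq]
  refine (summable_norm_coeff _).tsum_le_tsum (fun j => ?_)
    (summable_norm_sum_mul_antidiagonal_of_summable_norm hp hq).of_norm
  rw [coeff_mul]
  refine (norm_sum_le _ _).trans (le_of_eq ?_)
  simp

theorem coeffNorm_monomial (n : ℕ) (a : ℂ) : coeffNorm (monomial n a) = ‖a‖ := by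
  unfold coeffNorm
  rw [tsum_eq_single n]
  · simp
  · intro j hj
    simp [coeff_monomial, hj.symm]

theorem coeffNorm_C (a : ℂ) : coeffNorm (C a) = ‖a‖ := coeffNorm_monomial 0 a

theorem coeffNorm_X_pow (n : ℕ) : coeffNorm (X ^ n) = 1 := by
  rw [X_pow_eq_monomial, coeffNorm_monomial, norm_one]

theorem coeffNorm_sum_le {α : Type*} (s : Finset α) (p : α → ℂ[X]) :
    coeffNorm (∑ i ∈ s, p i) ≤ ∑ i ∈ s, coeffNorm (p i) := by
  classical
  induction s using Finset.induction_on with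
  | empty => simp [coeffNorm]
  | insert i s hi ih =>
    rw [Finset.sum_insert hi, Finset.sum_insert hi]
    exact (coeffNorm_add_le _ _).trans (by gcongr)

theorem coeffNorm_pow_le_one {p : ℂ[X]} (hp : coeffNorm p ≤ 1) (n : ℕ) :
    coeffNorm (p ^ n) ≤ 1 := by
  induction n with
  | zero => simpa using (coeffNorm_X_pow 0).le
  | succ n ih =>
    rw [pow_succ]
    exact (coeffNorm_mul_le _ _).trans (mul_le_one₀ ih (coeffNorm_nonneg _) hp)

/-- `(1 + X²) / 2`, which is `X · (X + X⁻¹) / 2`. -/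
def cosNumerator : ℂ[X] := C 2⁻¹ * (1 + X ^ 2)

theorem coeffNorm_cosNumerator_le : coeffNorm cosNumerator ≤ 1 := by
  have h1 : coeffNorm (1 : ℂ[X]) = 1 := by simpa using coeffNorm_X_pow 0
  have := coeffNorm_add_le 1 (X ^ 2)
  rw [h1, coeffNorm_X_pow] at this
  refine (coeffNorm_mul_le _ _).trans ?_
  rw [coeffNorm_C, norm_inv, Complex.norm_ofNat]
  linarith

theorem natDegree_cosNumerator_le : cosNumerator.natDegree ≤ 2 := by
  unfold cosNumerator
  compute_degree

theorem reflect_cosNumerator : reflect 2 cosNumerator = cosNumerator := by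
  rw [cosNumerator, reflect_C_mul, reflect_add, reflect_one, reflect_monomial,
    revAt_le le_rfl, Nat.sub_self, pow_zero, add_comm]

theorem reflect_cosNumerator_pow (m : ℕ) :
    reflect (2 * m) (cosNumerator ^ m) = cosNumerator ^ m := by
  induction m with
  | zero => simp [reflect_one]
  | succ m ih =>
    rw [pow_succ, Nat.mul_succ, reflect_mul _ _ _ natDegree_cosNumerator_le, ih,
      reflect_cosNumerator]
    rw [mul_comm 2 m]
    exact natDegree_pow_le_of_le m natDegree_cosNumerator_le

/-- `X ^ M` times the truncation at degree `M` of the exponential series of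
`a · (X + X⁻¹) / 2`. -/
def expCos (a : ℂ) (M : ℕ) : ℂ[X] :=
  ∑ m ∈ Finset.range (M + 1), C (a ^ m / m.factorial) * (cosNumerator ^ m * X ^ (M - m))

theorem natDegree_cosNumerator_pow_mul_le {m M : ℕ} (h : m ≤ M) :
    (cosNumerator ^ m * X ^ (M - m)).natDegree ≤ 2 * M := by
  have h1 := natDegree_pow_le_of_le m natDegree_cosNumerator_le
  have h2 := natDegree_X_pow_le (R := ℂ) (M - m)
  have := natDegree_mul_le_of_le h1 h2
  omega

theorem natDegree_expCos_le (a : ℂ) (M : ℕ) : (expCos a M).natDegree ≤ 2 * M := by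
  refine natDegree_sum_le_of_forall_le _ _ fun m hm => ?_
  exact (natDegree_C_mul_le _ _).trans
    (natDegree_cosNumerator_pow_mul_le (Nat.lt_succ_iff.1 (Finset.mem_range.1 hm)))

theorem map_cosNumerator : cosNumerator.map (starRingEnd ℂ) = cosNumerator := by
  rw [cosNumerator, Polynomial.map_mul, map_C, map_inv₀, Complex.conj_ofNat]
  simp

theorem reflect_sum {R α : Type*} [Semiring R] (N : ℕ) (s : Finset α) (p : α → R[X]) :
    reflect N (∑ i ∈ s, p i) = ∑ i ∈ s, reflect N (p i) := by
  classical
  induction s using Finset.induction_on with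
  | empty => simp
  | insert i s hi ih => rw [Finset.sum_insert hi, Finset.sum_insert hi, reflect_add, ih]

/-- On the unit circle, conjugating the coefficients and reflecting at `2 * M` is complex
conjugation times `z ^ (2 * M)`. The cosine is real there, so only `a` gets conjugated. -/
theorem reflect_map_expCos (a : ℂ) (M : ℕ) :
    reflect (2 * M) ((expCos a M).map (starRingEnd ℂ)) = expCos (starRingEnd ℂ a) M := by
  unfold expCos
  rw [Polynomial.map_sum, reflect_sum]
  refine Finset.sum_congr rfl fun m hm => ?_
  have hm : m ≤ M := Nat.lt_succ_iff.1 (Finset.mem_range.1 hm)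
  rw [Polynomial.map_mul, map_C, reflect_C_mul, Polynomial.map_mul, Polynomial.map_pow,
    map_cosNumerator, Polynomial.map_pow, map_X]
  have h2 : 2 * M = 2 * m + 2 * (M - m) := by omega
  rw [h2, reflect_mul, reflect_cosNumerator_pow, reflect_monomial, revAt_le (by omega)]
  · have h3 : 2 * (M - m) - (M - m) = M - m := by omega
    rw [h3]
    simp
  · rw [mul_comm 2 m]
    exact natDegree_pow_le_of_le m natDegree_cosNumerator_le
  · exact (natDegree_X_pow_le _).trans (by omega)

/-- The autocorrelation of a finite sequence is a coefficient of the product of its generating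
polynomial with the reflected conjugate polynomial. -/
theorem sum_conj_coeff_mul_coeff_add {p : ℂ[X]} {d : ℕ} (hp : p.natDegree ≤ d) (l : ℕ) :
    ∑ j ∈ Finset.range (d + 1), starRingEnd ℂ (p.coeff j) * p.coeff (j + l) =
      ((p.map (starRingEnd ℂ)).reflect d * p).coeff (d + l) := by
  rw [coeff_mul, Finset.Nat.sum_antidiagonal_eq_sum_range_succ_mk,
    ← Finset.sum_range_reflect]
  symm
  have hsub : Finset.range (d + 1) ⊆ Finset.range (d + l).succ :=
    Finset.range_subset_range.2 (by omega)
  rw [← Finset.sum_subset hsub]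
  · refine Finset.sum_congr rfl fun j hj => ?_
    have hj : j ≤ d := Nat.lt_succ_iff.1 (Finset.mem_range.1 hj)
    rw [coeff_reflect, revAt_le hj, coeff_map]
    congr 3
    omega
  · intro j _ hj
    have hj : d < j := by simpa using hj
    rw [coeff_reflect, revAt_eq_self_of_lt hj, coeff_map,
      coeff_eq_zero_of_natDegree_lt (hp.trans_lt hj), map_zero, zero_mul]

theorem sum_antidiagonal_pow_div_factorial (x y : ℂ) (s : ℕ) :
    ∑ k ∈ Finset.HasAntidiagonal.antidiagonal s,
        x ^ k.1 / k.1.factorial * (y ^ k.2 / k.2.factorial) =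
      (x + y) ^ s / s.factorial := by
  rw [(Commute.all x y).add_pow', Finset.sum_div]
  refine Finset.sum_congr rfl fun k hk => ?_
  obtain rfl := Finset.HasAntidiagonal.mem_antidiagonal.1 hk
  have h := Nat.add_choose_mul_factorial_mul_factorial k.1 k.2
  rw [← Nat.choose_symm_add] at h
  have h' : (((k.1 + k.2).choose k.1 : ℕ) : ℂ) * k.1.factorial * k.2.factorial =
      (k.1 + k.2).factorial := by exact_mod_cast h
  have h1 : (k.1.factorial : ℂ) ≠ 0 := by exact_mod_cast k.1.factorial_ne_zero
  have h2 : (k.2.factorial : ℂ) ≠ 0 := by exact_mod_cast k.2.factorial_ne_zero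
  have h3 : ((k.1 + k.2).factorial : ℂ) ≠ 0 := by exact_mod_cast (k.1 + k.2).factorial_ne_zero
  rw [nsmul_eq_mul]
  field_simp
  rw [← h']
  ring

theorem expCos_mul_expCos (a b : ℂ) (M : ℕ) :
    expCos a M * expCos b M =
      ∑ k ∈ Finset.range (M + 1) ×ˢ Finset.range (M + 1),
        C (a ^ k.1 / k.1.factorial * (b ^ k.2 / k.2.factorial)) *
          (cosNumerator ^ (k.1 + k.2) * X ^ (2 * M - (k.1 + k.2))) := by
  unfold expCos
  rw [Finset.sum_mul_sum, Finset.sum_product]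
  refine Finset.sum_congr rfl fun m hm => Finset.sum_congr rfl fun m' hm' => ?_
  have hm : m ≤ M := Nat.lt_succ_iff.1 (Finset.mem_range.1 hm)
  have hm' : m' ≤ M := Nat.lt_succ_iff.1 (Finset.mem_range.1 hm')
  have h : 2 * M - (m + m') = (M - m) + (M - m') := by omega
  rw [h, C_mul, pow_add, pow_add]
  ring

/-- The pairs of total degree `s ≤ M` form a full antidiagonal, so by the binomial theorem they
contribute a multiple of `(-a + a) ^ s / s!`, which vanishes unless `s = 0`. -/
theorem sum_filter_low_degree (a : ℂ) (M : ℕ) :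
    ∑ k ∈ (Finset.range (M + 1) ×ˢ Finset.range (M + 1)).filter (fun k => k.1 + k.2 ≤ M),
        C ((-a) ^ k.1 / k.1.factorial * (a ^ k.2 / k.2.factorial)) *
          (cosNumerator ^ (k.1 + k.2) * X ^ (2 * M - (k.1 + k.2))) = X ^ (2 * M) := by
  rw [← Finset.sum_fiberwise_of_maps_to (t := Finset.range (M + 1)) (g := fun k => k.1 + k.2)]
  · rw [Finset.sum_eq_single 0]
    · rw [Finset.sum_eq_single (0, 0)] <;> simp +contextual
    · intro s hs hs0
      have hset : (((Finset.range (M + 1) ×ˢ Finset.range (M + 1)).filter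
          (fun k => k.1 + k.2 ≤ M)).filter fun k => k.1 + k.2 = s) =
          Finset.HasAntidiagonal.antidiagonal s := by
        ext k
        simp only [Finset.mem_filter, Finset.mem_product, Finset.mem_range,
          Finset.HasAntidiagonal.mem_antidiagonal] at hs ⊢
        omega
      rw [hset]
      have : ∀ k ∈ Finset.HasAntidiagonal.antidiagonal s,
          C ((-a) ^ k.1 / k.1.factorial * (a ^ k.2 / k.2.factorial)) *
            (cosNumerator ^ (k.1 + k.2) * X ^ (2 * M - (k.1 + k.2))) =
          C ((-a) ^ k.1 / k.1.factorial * (a ^ k.2 / k.2.factorial)) *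
            (cosNumerator ^ s * X ^ (2 * M - s)) := by
        intro k hk
        rw [Finset.HasAntidiagonal.mem_antidiagonal.1 hk]
      rw [Finset.sum_congr rfl this, ← Finset.sum_mul, ← map_sum,
        sum_antidiagonal_pow_div_factorial]
      simp [hs0]
    · simp
  · intro k hk
    simp only [Finset.mem_filter, Finset.mem_range] at hk ⊢
    omega

/-- Only the products of total degree above `M` survive. Weighting each by `2 ^ (k.1 + k.2 - M) ≥ 1`
bounds them by `2⁻¹ ^ M` times two exponential series at `2 * ‖a‖`; the cosine powers have
coefficient norm at most one. -/
theorem coeffNorm_expCos_mul_sub_le (a : ℂ) (M : ℕ) :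
    coeffNorm (expCos (-a) M * expCos a M - X ^ (2 * M)) ≤
      2⁻¹ ^ M * Real.exp (4 * ‖a‖) := by
  rw [expCos_mul_expCos, ← Finset.sum_filter_add_sum_filter_not _ (fun k => k.1 + k.2 ≤ M),
    sum_filter_low_degree, add_sub_cancel_left]
  refine (coeffNorm_sum_le _ _).trans ?_
  have hterm : ∀ k ∈ (Finset.range (M + 1) ×ˢ Finset.range (M + 1)).filter
      (fun k => ¬ k.1 + k.2 ≤ M),
      coeffNorm (C ((-a) ^ k.1 / k.1.factorial * (a ^ k.2 / k.2.factorial)) *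
          (cosNumerator ^ (k.1 + k.2) * X ^ (2 * M - (k.1 + k.2)))) ≤
        2⁻¹ ^ M * ((2 * ‖a‖) ^ k.1 / k.1.factorial * ((2 * ‖a‖) ^ k.2 / k.2.factorial)) := by
    intro k hk
    have hk : M ≤ k.1 + k.2 := by
      have := (Finset.mem_filter.1 hk).2
      omega
    have h1 : coeffNorm (cosNumerator ^ (k.1 + k.2) * X ^ (2 * M - (k.1 + k.2))) ≤ 1 := by
      refine (coeffNorm_mul_le _ _).trans ?_
      rw [coeffNorm_X_pow, mul_one]
      exact coeffNorm_pow_le_one coeffNorm_cosNumerator_le _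
    refine (coeffNorm_mul_le _ _).trans ((mul_le_of_le_one_right (coeffNorm_nonneg _) h1).trans ?_)
    rw [coeffNorm_C]
    simp only [norm_mul, norm_div, norm_pow, norm_neg, Complex.norm_natCast]
    have h2 : (1 : ℝ) ≤ 2⁻¹ ^ M * 2 ^ (k.1 + k.2) := by
      rw [inv_pow, ← div_eq_inv_mul, le_div_iff₀ (by positivity), one_mul]
      exact pow_le_pow_right₀ (by norm_num) hk
    have h3 : 0 ≤ ‖a‖ ^ k.1 / k.1.factorial * (‖a‖ ^ k.2 / k.2.factorial) := by positivity
    refine (le_mul_of_one_le_left h3 h2).trans (le_of_eq ?_)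
    rw [mul_pow, mul_pow, pow_add]
    ring
  refine (Finset.sum_le_sum hterm).trans ?_
  rw [← Finset.mul_sum]
  refine mul_le_mul_of_nonneg_left ?_ (by positivity)
  refine (Finset.sum_le_sum_of_subset_of_nonneg (Finset.filter_subset _ _)
    fun _ _ _ => by positivity).trans ?_
  rw [Finset.sum_product]
  dsimp only
  rw [← Finset.sum_mul_sum]
  have h := Real.sum_le_exp_of_nonneg (x := 2 * ‖a‖) (by positivity) (M + 1)
  have h4 : Real.exp (4 * ‖a‖) = Real.exp (2 * ‖a‖) * Real.exp (2 * ‖a‖) := by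
    rw [← Real.exp_add]
    ring_nf
  rw [h4]
  exact mul_le_mul h h (by positivity) (by positivity)

/-- The autocorrelation of the coefficients of `expCos a M` for imaginary `a` is close to that of
a unimodular function. -/
theorem sum_norm_autocorrelation_expCos_le {a : ℂ} (ha : starRingEnd ℂ a = -a) (M : ℕ) :
    ‖∑ j ∈ Finset.range (2 * M + 1),
        starRingEnd ℂ ((expCos a M).coeff j) * (expCos a M).coeff j‖ +
      2 * ∑ l ∈ Finset.range (2 * M), ‖∑ j ∈ Finset.range (2 * M + 1),
        starRingEnd ℂ ((expCos a M).coeff j) * (expCos a M).coeff (j + (l + 1))‖ ≤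
      1 + 2 * (2⁻¹ ^ M * Real.exp (4 * ‖a‖)) := by
  -- For imaginary `a` the reflected conjugate of `expCos a M` is `expCos (-a) M`, so the
  -- autocorrelations are the coefficients of a product that is close to `X ^ (2 * M)`.
  have hc : ∀ l, ∑ j ∈ Finset.range (2 * M + 1),
      starRingEnd ℂ ((expCos a M).coeff j) * (expCos a M).coeff (j + l) =
      (if l = 0 then 1 else 0) +
        (expCos (-a) M * expCos a M - X ^ (2 * M)).coeff (2 * M + l) := by
    intro l
    rw [sum_conj_coeff_mul_coeff_add (natDegree_expCos_le a M), reflect_map_expCos, ha,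
      coeff_sub, coeff_X_pow]
    simp
  set e := expCos (-a) M * expCos a M - X ^ (2 * M) with he
  have h0 := hc 0
  simp only [add_zero, if_true] at h0
  rw [h0]
  have h1 : ∀ l ∈ Finset.range (2 * M), ‖∑ j ∈ Finset.range (2 * M + 1),
      starRingEnd ℂ ((expCos a M).coeff j) * (expCos a M).coeff (j + (l + 1))‖ =
      ‖e.coeff (2 * M + (l + 1))‖ := by
    intro l _
    rw [hc]
    simp
  rw [Finset.sum_congr rfl h1]
  have h2 : ∑ l ∈ Finset.range (2 * M + 1), ‖e.coeff (2 * M + l)‖ ≤ coeffNorm e := by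
    refine le_trans (le_of_eq ?_) (sum_norm_coeff_le_coeffNorm e
      ((Finset.range (2 * M + 1)).map (addLeftEmbedding (2 * M))))
    rw [Finset.sum_map]
    rfl
  rw [Finset.sum_range_succ', add_zero] at h2
  have h3 := coeffNorm_expCos_mul_sub_le a M
  rw [← he] at h3
  have h4 := norm_add_le (1 : ℂ) (e.coeff (2 * M))
  rw [norm_one] at h4
  have h5 := norm_nonneg (e.coeff (2 * M))
  linarith

end

/-! ### Completion to a unit vector polynomial and to a unitary matrix -/

noncomputable section

open Matrix


/-- A scalar polynomial whose autocorrelations have absolute sum at most one is a component of a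
vector polynomial of unit norm on the unit circle. -/
theorem exists_unit_completion (d : ℕ) (p : ℕ → ℂ) (hp : ∀ j, d < j → p j = 0)
    (hs : ‖∑ j ∈ Finset.range (d + 1), starRingEnd ℂ (p j) * p j‖ +
      2 * ∑ l ∈ Finset.range d, ‖∑ j ∈ Finset.range (d + 1),
        starRingEnd ℂ (p j) * p (j + (l + 1))‖ ≤ 1) :
    ∃ v : ℕ → Option (Option (Fin d)) → ℂ, (∀ j, v j none = p j) ∧ (∀ j, d < j → v j = 0) ∧
      ∀ l, ∑ j ∈ Finset.range (d + 1), star (v j) ⬝ᵥ v (j + l) = if l = 0 then 1 else 0 := by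
  set s : ℕ → ℂ := fun l => ∑ j ∈ Finset.range (d + 1), starRingEnd ℂ (p j) * p (j + l) with hsdef
  set S : ℝ := ∑ l ∈ Finset.range d, ‖s (l + 1)‖ with hS
  have hs0 : s 0 = ((‖s 0‖ : ℝ) : ℂ) := by
    have : s 0 = ((∑ j ∈ Finset.range (d + 1), ‖p j‖ ^ 2 : ℝ) : ℂ) := by
      simp only [hsdef, add_zero]
      push_cast
      exact Finset.sum_congr rfl fun j _ => Complex.conj_mul' _
    rw [this, Complex.norm_real, Real.norm_of_nonneg (by positivity)]
  have hs' : 0 ≤ 1 - ‖s 0‖ - 2 * S := by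
    have : ‖s 0‖ + 2 * S ≤ 1 := hs
    linarith
  set r : ℝ := √(1 - ‖s 0‖ - 2 * S) with hr
  -- The completion writes `1 - |p|²` on the circle as `r² + ∑ |α l + β l z ^ l|²` over the lags `l`
  -- from `1` to `d`: the cross term of each binomial cancels the autocorrelation `s l`, and its
  -- constant part `2 ‖s l‖` is paid for by the hypothesis. If `s l = 0`, then `β l = 0` because
  -- division by zero gives zero.
  let α : ℕ → ℂ := fun l => ((√‖s l‖ : ℝ) : ℂ)
  let β : ℕ → ℂ := fun l => -s l / ((√‖s l‖ : ℝ) : ℂ)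
  have hαβ : ∀ l, starRingEnd ℂ (α l) * β l = -s l := by
    intro l
    simp only [α, β, Complex.conj_ofReal]
    by_cases h : s l = 0
    · simp [h]
    · have : ((√‖s l‖ : ℝ) : ℂ) ≠ 0 := by
        rw [Complex.ofReal_ne_zero]
        exact (Real.sqrt_pos.2 (norm_pos_iff.2 h)).ne'
      field_simp
  have hα : ∀ l, starRingEnd ℂ (α l) * α l = ((‖s l‖ : ℝ) : ℂ) := by
    intro l
    simp only [α, Complex.conj_ofReal]
    rw [← Complex.ofReal_mul, Real.mul_self_sqrt (norm_nonneg _)]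
  have hβ : ∀ l, starRingEnd ℂ (β l) * β l = ((‖s l‖ : ℝ) : ℂ) := by
    intro l
    rw [Complex.conj_mul']
    simp only [β, norm_div, norm_neg, Complex.norm_real, Real.norm_of_nonneg (Real.sqrt_nonneg _)]
    rw [← Complex.ofReal_pow, div_pow, Real.sq_sqrt (norm_nonneg _), sq, mul_self_div_self]
  let v : ℕ → Option (Option (Fin d)) → ℂ := fun j i => i.elim (p j)
    fun i => i.elim (if j = 0 then (r : ℂ) else 0)
      fun k => if j = 0 then α (k + 1) else if j = k + 1 then β (k + 1) else 0
  refine ⟨v, fun j => rfl, ?_, ?_⟩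
  · intro j hj
    have hj0 : j ≠ 0 := by omega
    funext i
    rcases i with _ | _ | k
    · exact hp j hj
    · simp [v, hj0]
    · have : j ≠ k + 1 := by have := k.2; omega
      simp [v, hj0, this]
  · intro l
    have hk : ∀ k : Fin d, ∑ j ∈ Finset.range (d + 1),
        starRingEnd ℂ (v j (some (some k))) * v (j + l) (some (some k)) =
        if l = 0 then 2 * ((‖s (k + 1)‖ : ℝ) : ℂ) else if l = k + 1 then -s (k + 1) else 0 := by
      intro k
      have hsub : ({0, (k : ℕ) + 1} : Finset ℕ) ⊆ Finset.range (d + 1) := by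
        intro x hx
        have := k.2
        simp only [Finset.mem_insert, Finset.mem_singleton, Finset.mem_range] at hx ⊢
        omega
      rw [← Finset.sum_subset hsub, Finset.sum_pair (by omega)]
      · by_cases hl : l = 0
        · subst hl
          simp only [v, Option.elim, add_zero, if_true, Nat.add_eq_zero_iff, one_ne_zero, and_false,
            if_false, hα, hβ]
          ring
        · have h1 : (k : ℕ) + 1 + l ≠ (k : ℕ) + 1 := by omega
          by_cases hlk : l = k + 1
          · simp only [v, Option.elim, hlk, zero_add, if_true, Nat.add_eq_zero_iff, one_ne_zero,
              and_false, if_false, hαβ]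
            simp
          · simp [v, hl, hlk]
      · intro j _ hj
        simp only [Finset.mem_insert, Finset.mem_singleton, not_or] at hj
        simp [v, hj.1, hj.2]
    have hr' : ∑ j ∈ Finset.range (d + 1),
        starRingEnd ℂ (v j (some none)) * v (j + l) (some none) =
        if l = 0 then ((1 - ‖s 0‖ - 2 * S : ℝ) : ℂ) else 0 := by
      rw [Finset.sum_eq_single 0]
      · simp only [v, Option.elim, if_true, Complex.conj_ofReal, zero_add]
        split_ifs
        · rw [← Complex.ofReal_mul, hr, Real.mul_self_sqrt hs']
        · simp
      · intro j _ hj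
        simp [v, hj]
      · simp
    have hsum : ∑ j ∈ Finset.range (d + 1), star (v j) ⬝ᵥ v (j + l) =
        s l + ((if l = 0 then ((1 - ‖s 0‖ - 2 * S : ℝ) : ℂ) else 0) + ∑ k : Fin d,
        if l = 0 then 2 * ((‖s (k + 1)‖ : ℝ) : ℂ) else if l = k + 1 then -s (k + 1) else 0) := by
      rw [← hr', ← Finset.sum_congr rfl fun k _ => hk k, Finset.sum_comm, ← Finset.sum_add_distrib,
        hsdef, ← Finset.sum_add_distrib]
      refine Finset.sum_congr rfl fun j _ => ?_
      rw [dotProduct, Fintype.sum_option, Fintype.sum_option]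
      rfl
    rw [hsum]
    by_cases hl : l = 0
    · subst hl
      simp only [if_true]
      rw [← Finset.mul_sum, Fin.sum_univ_eq_sum_range (fun k => ((‖s (k + 1)‖ : ℝ) : ℂ)), hs0, hS]
      push_cast
      simp
    · simp only [hl, if_false, zero_add]
      rw [Fin.sum_univ_eq_sum_range (fun k => if l = k + 1 then -s (k + 1) else 0)]
      obtain ⟨m, rfl⟩ : ∃ m, l = m + 1 := ⟨l - 1, by omega⟩
      by_cases hm : m < d
      · rw [Finset.sum_eq_single m]
        · simp
        · intro k _ hk
          rw [if_neg (by omega)]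
        · intro h
          exact absurd (Finset.mem_range.2 hm) h
      · rw [Finset.sum_eq_zero, add_zero]
        · refine Finset.sum_eq_zero fun j _ => ?_
          rw [hp (j + (m + 1)) (by omega), mul_zero]
        · intro k hk
          have := Finset.mem_range.1 hk
          rw [if_neg (by omega)]

/-- Every unit vector is a column of a unitary matrix. -/
theorem exists_unitary_mulVec_single {ι : Type} [Fintype ι] [DecidableEq ι] (i₀ : ι) (u : ι → ℂ)
    (hu : star u ⬝ᵥ u = 1) : ∃ R : Matrix.unitaryGroup ι ℂ, ∀ i, R.1 i i₀ = u i := by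
  have hv : Orthonormal ℂ (({i₀} : Set ι).domRestrict fun _ => WithLp.toLp 2 u) := by
    rw [orthonormal_iff_ite]
    rintro ⟨i, hi⟩ ⟨j, hj⟩
    obtain rfl : i = i₀ := hi
    obtain rfl : j = i := hj
    rw [if_pos rfl]
    change inner ℂ (WithLp.toLp 2 u) (WithLp.toLp 2 u) = (1 : ℂ)
    rw [EuclideanSpace.inner_toLp_toLp, dotProduct_comm, hu]
  obtain ⟨b, hb⟩ := hv.exists_orthonormalBasis_extension_of_card_eq (by simp)
  refine ⟨⟨Matrix.of fun i j => b j i, ?_⟩, fun i => ?_⟩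
  · rw [mem_unitaryGroup_iff']
    ext i j
    have := orthonormal_iff_ite.1 b.orthonormal i j
    rw [Matrix.mul_apply, one_apply, ← this, EuclideanSpace.inner_eq_star_dotProduct, dotProduct]
    refine Finset.sum_congr rfl fun k _ => ?_
    simp [mul_comm]
  · simp [hb i₀ rfl]

end

/-! ### Stacks of blocks, controlled operators and operators realizable with few queries -/

noncomputable section

open Matrix


/-- The matrix with rows indexed by `Y × ι` that stacks the matrices `B i`. -/
def stack {ι Y Z : Type} (B : ι → Matrix Y Z ℂ) : Matrix (Y × ι) Z ℂ :=
  Matrix.of fun x z => B x.2 x.1 z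

section Stack

variable {ι Y Z : Type} [Fintype ι] [DecidableEq ι] [Fintype Y] [DecidableEq Y]

theorem blockDiagonal_mul_stack (M : ι → Matrix Y Y ℂ) (B : ι → Matrix Y Z ℂ) :
    blockDiagonal M * stack B = stack fun i => M i * B i := by
  ext ⟨y, i⟩ z
  simp [stack, Matrix.mul_apply, Fintype.sum_prod_type, blockDiagonal_apply]

theorem stack_mul {X : Type} [Fintype Z] (B : ι → Matrix Y Z ℂ) (A : Matrix Z X ℂ) :
    stack B * A = stack fun i => B i * A := rfl

theorem conjTranspose_stack_mul_stack {X : Type} (A : ι → Matrix Y X ℂ) (B : ι → Matrix Y Z ℂ) :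
    (stack A)ᴴ * stack B = ∑ i, (A i)ᴴ * B i := by
  ext x z
  simp [stack, Matrix.mul_apply, Fintype.sum_prod_type, Matrix.sum_apply]
  exact Finset.sum_comm

/-- The operator `R` on the index of a stack. -/
def onIndex (Y : Type) [DecidableEq Y] (R : Matrix ι ι ℂ) : Matrix (Y × ι) (Y × ι) ℂ :=
  Matrix.of fun x y => if x.1 = y.1 then R x.2 y.2 else 0

theorem onIndex_mul_stack (R : Matrix ι ι ℂ) (B : ι → Matrix Y Z ℂ) :
    onIndex Y R * stack B = stack fun i => ∑ k, R i k • B k := by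
  ext ⟨y, i⟩ z
  simp [stack, onIndex, Matrix.mul_apply, Fintype.sum_prod_type, Matrix.sum_apply]

theorem onIndex_mul (R S : Matrix ι ι ℂ) : onIndex Y R * onIndex Y S = onIndex Y (R * S) := by
  ext ⟨y, i⟩ ⟨z, k⟩
  by_cases h : y = z
  · simp [onIndex, Matrix.mul_apply, Fintype.sum_prod_type, h]
  · simp [onIndex, Matrix.mul_apply, Fintype.sum_prod_type, h]

theorem conjTranspose_onIndex (R : Matrix ι ι ℂ) : (onIndex Y R)ᴴ = onIndex Y Rᴴ := by
  ext ⟨y, i⟩ ⟨z, k⟩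
  by_cases h : y = z
  · simp [onIndex, h]
  · simp [onIndex, h, Ne.symm h]

theorem onIndex_one : onIndex Y (1 : Matrix ι ι ℂ) = 1 := by
  ext ⟨y, i⟩ ⟨z, k⟩
  by_cases h : y = z <;> simp [onIndex, h, one_apply]

theorem onIndex_mem_unitaryGroup {R : Matrix ι ι ℂ} (hR : R ∈ unitaryGroup ι ℂ) :
    onIndex Y R ∈ unitaryGroup (Y × ι) ℂ := by
  rw [mem_unitaryGroup_iff, star_eq_conjTranspose, conjTranspose_onIndex, onIndex_mul,
    ← star_eq_conjTranspose, mem_unitaryGroup_iff.1 hR, onIndex_one]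

theorem blockDiagonal_mem_unitaryGroup {M : ι → Matrix Y Y ℂ}
    (hM : ∀ i, M i ∈ unitaryGroup Y ℂ) : blockDiagonal M ∈ unitaryGroup (Y × ι) ℂ := by
  rw [mem_unitaryGroup_iff, star_eq_conjTranspose, blockDiagonal_conjTranspose,
    ← blockDiagonal_mul, ← blockDiagonal_one]
  congr 1
  funext i
  exact mem_unitaryGroup_iff.1 (hM i)

/-- The operator that applies `W` if the index is `i₀`. -/
def controlled (i₀ : ι) (W : Matrix Y Y ℂ) : Matrix (Y × ι) (Y × ι) ℂ :=
  blockDiagonal fun i => if i = i₀ then W else 1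

/-- The stack with the block `G` at `i₀` and zeros elsewhere. -/
def stackAt (i₀ : ι) (G : Matrix Y Z ℂ) : Matrix (Y × ι) Z ℂ :=
  stack fun i => if i = i₀ then G else 0

theorem onIndex_mul_stackAt (i₀ : ι) (R : Matrix ι ι ℂ) (G : Matrix Y Z ℂ) :
    onIndex Y R * stackAt i₀ G = stack fun i => R i i₀ • G := by
  rw [stackAt, onIndex_mul_stack]
  congr 1
  funext i
  simp

/-- The operator `W` on `Y`, whatever the index. -/
def uncontrolled (ι : Type) [DecidableEq ι] (W : Matrix Y Y ℂ) : Matrix (Y × ι) (Y × ι) ℂ :=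
  blockDiagonal fun _ => W

theorem controlled_mem_unitaryGroup (i₀ : ι) {W : Matrix Y Y ℂ} (hW : W ∈ unitaryGroup Y ℂ) :
    controlled i₀ W ∈ unitaryGroup (Y × ι) ℂ := by
  refine blockDiagonal_mem_unitaryGroup fun i => ?_
  split_ifs
  exacts [hW, one_mem _]

end Stack

section Realizes

variable {n b : ℕ} {ι : Type} [Fintype ι] [DecidableEq ι]

/-- The operator applied by a list of steps. -/
def runSteps {Anc : Type} [Fintype Anc] [DecidableEq Anc] (f : QIndex n → Equiv.Perm (QIndex n))
    (h : QIndex n → QIndex n → BitString b) (s : List (Step n b Anc)) :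
    Matrix (FullBasis n b Anc) (FullBasis n b Anc) ℂ :=
  s.foldl (fun M s => s.toMatrix f h * M) 1

theorem foldl_toMatrix_mul {Anc : Type} [Fintype Anc] [DecidableEq Anc]
    (f : QIndex n → Equiv.Perm (QIndex n)) (h : QIndex n → QIndex n → BitString b)
    (s : List (Step n b Anc)) (A : Matrix (FullBasis n b Anc) (FullBasis n b Anc) ℂ) :
    s.foldl (fun M s => s.toMatrix f h * M) A = runSteps f h s * A := by
  unfold runSteps
  induction s generalizing A with
  | nil => simp
  | cons x s ih =>
    rw [List.foldl_cons, List.foldl_cons, ih, ih (x.toMatrix f h * 1), mul_one, Matrix.mul_assoc]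

theorem runSteps_append {Anc : Type} [Fintype Anc] [DecidableEq Anc]
    (f : QIndex n → Equiv.Perm (QIndex n)) (h : QIndex n → QIndex n → BitString b)
    (s s' : List (Step n b Anc)) :
    runSteps f h (s ++ s') = runSteps f h s' * runSteps f h s := by
  rw [runSteps, List.foldl_append, foldl_toMatrix_mul]
  rfl

/-- Splits off the part `ι` of the workspace. -/
def splitIndex (n b : ℕ) (ι : Type) : FullBasis n b (Bool × ι) ≃ FullBasis n b Bool × ι where
  toFun x := ((x.1, x.2.1, x.2.2.1, x.2.2.2.1), x.2.2.2.2)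
  invFun x := (x.1.1, x.1.2.1, x.1.2.2.1, x.1.2.2.2, x.2)
  left_inv _ := rfl
  right_inv _ := rfl

/-- An operator that depends on the oracles can be applied with at most `q` queries. -/
def Realizes (q : ℕ) (T : (QIndex n → Equiv.Perm (QIndex n)) →
    (QIndex n → QIndex n → BitString b) →
    Matrix (FullBasis n b Bool × ι) (FullBasis n b Bool × ι) ℂ) : Prop :=
  ∃ s : List (Step n b (Bool × ι)), (s.map Step.queries).sum ≤ q ∧
    ∀ f h, runSteps f h s = (T f h).submatrix (splitIndex n b ι) (splitIndex n b ι)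

variable {q q' : ℕ} {T T' : (QIndex n → Equiv.Perm (QIndex n)) →
    (QIndex n → QIndex n → BitString b) →
    Matrix (FullBasis n b Bool × ι) (FullBasis n b Bool × ι) ℂ}

theorem Realizes.mono (hT : Realizes q T) (hq : q ≤ q') : Realizes q' T := by
  obtain ⟨s, hs, h⟩ := hT
  exact ⟨s, hs.trans hq, h⟩

theorem Realizes.mul (hT : Realizes q T) (hT' : Realizes q' T') :
    Realizes (q + q') fun f h => T f h * T' f h := by
  obtain ⟨s, hs, h⟩ := hT
  obtain ⟨s', hs', h'⟩ := hT'
  refine ⟨s' ++ s, ?_, fun f g => ?_⟩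
  · rw [List.map_append, List.sum_append]
    omega
  · rw [runSteps_append, h, h', submatrix_mul_equiv]

theorem Realizes.gate {U : Matrix (FullBasis n b Bool × ι) (FullBasis n b Bool × ι) ℂ}
    (hU : U ∈ unitaryGroup _ ℂ) : Realizes 0 fun _ _ => U := by
  refine ⟨[.gate ⟨U.submatrix (splitIndex n b ι) (splitIndex n b ι), ?_⟩], by simp [Step.queries],
    fun f h => ?_⟩
  · rw [mem_unitaryGroup_iff, star_eq_conjTranspose, conjTranspose_submatrix, submatrix_mul_equiv,
      ← star_eq_conjTranspose, mem_unitaryGroup_iff.1 hU, submatrix_one_equiv]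
  · simp [runSteps, Step.toMatrix]

theorem Realizes.one : Realizes 0 fun _ _ =>
    (1 : Matrix (FullBasis n b Bool × ι) (FullBasis n b Bool × ι) ℂ) :=
  Realizes.gate (one_mem _)

theorem Realizes.queryF : Realizes 1 fun f h =>
    uncontrolled ι ((Step.queryF : Step n b Bool).toMatrix f h) := by
  refine ⟨[.queryF], by simp [Step.queries], fun f h => ?_⟩
  ext ⟨j, k, z, a, i⟩ ⟨j', k', z', a', i'⟩
  simp only [runSteps, List.foldl_cons, List.foldl_nil, mul_one, Step.toMatrix, basisMap, of_apply,
    submatrix_apply, splitIndex, Equiv.coe_fn_mk, uncontrolled, blockDiagonal_apply, Prod.mk.injEq,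
    ← ite_and]
  congr 1
  apply propext
  tauto

theorem Realizes.queryFInv : Realizes 1 fun f h =>
    uncontrolled ι ((Step.queryFInv : Step n b Bool).toMatrix f h) := by
  refine ⟨[.queryFInv], by simp [Step.queries], fun f h => ?_⟩
  ext ⟨j, k, z, a, i⟩ ⟨j', k', z', a', i'⟩
  simp only [runSteps, List.foldl_cons, List.foldl_nil, mul_one, Step.toMatrix, basisMap, of_apply,
    submatrix_apply, splitIndex, Equiv.coe_fn_mk, uncontrolled, blockDiagonal_apply, Prod.mk.injEq,
    ← ite_and]
  congr 1
  apply propext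
  tauto

theorem Realizes.queryH : Realizes 1 fun f h =>
    uncontrolled ι ((Step.queryH : Step n b Bool).toMatrix f h) := by
  refine ⟨[.queryH], by simp [Step.queries], fun f h => ?_⟩
  ext ⟨j, k, z, a, i⟩ ⟨j', k', z', a', i'⟩
  simp only [runSteps, List.foldl_cons, List.foldl_nil, mul_one, Step.toMatrix, basisMap, of_apply,
    submatrix_apply, splitIndex, Equiv.coe_fn_mk, uncontrolled, blockDiagonal_apply, Prod.mk.injEq,
    ← ite_and]
  congr 1
  apply propext
  tauto

theorem Realizes.pow (hT : Realizes q T) (k : ℕ) : Realizes (q * k) fun f h => T f h ^ k := by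
  induction k with
  | zero => simpa using Realizes.one
  | succ k ih => simpa only [pow_succ, Nat.mul_succ] using ih.mul hT

end Realizes

end

/-! ### Applying a unit vector polynomial of the walk, by peeling off degrees -/

noncomputable section

open Matrix


theorem star_mulVec_dotProduct_mulVec {ι : Type} [Fintype ι] [DecidableEq ι] {R : Matrix ι ι ℂ}
    (hR : R ∈ unitaryGroup ι ℂ) (u w : ι → ℂ) : star (R *ᵥ u) ⬝ᵥ (R *ᵥ w) = star u ⬝ᵥ w := by
  rw [star_mulVec, ← dotProduct_mulVec, mulVec_mulVec, ← star_eq_conjTranspose,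
    mem_unitaryGroup_iff'.1 hR, one_mulVec]

/-- If a vector polynomial of degree `d + 1` has unit norm on the unit circle, its coefficients of
degrees `0` and `d + 1` are orthogonal. -/
theorem star_coeff_zero_dotProduct_coeff_top {ι : Type} [Fintype ι] {d : ℕ} {v : ℕ → ι → ℂ}
    (hv : ∀ j, d + 1 < j → v j = 0)
    (hc : ∀ l, ∑ j ∈ Finset.range (d + 1 + 1), star (v j) ⬝ᵥ v (j + l) = if l = 0 then 1 else 0) :
    star (v 0) ⬝ᵥ v (d + 1) = 0 := by
  have h := hc (d + 1)
  rw [Finset.sum_range_succ', Finset.sum_eq_zero, if_neg (by omega), zero_add, zero_add] at h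
  · exact h
  · intro j _
    rw [hv (j + 1 + (d + 1)) (by omega), dotProduct_zero]

/-- Dividing one coordinate, which has no constant term, by the variable preserves the
autocorrelation. -/
theorem sum_autocorrelation_shift {ι : Type} [Fintype ι] [DecidableEq ι] (i₀ : ι) {d : ℕ}
    {u : ℕ → ι → ℂ} (h0 : u 0 i₀ = 0)
    (htop : ∀ i, i ≠ i₀ → u (d + 1) i = 0) (l : ℕ) :
    ∑ j ∈ Finset.range (d + 1), star (fun i => if i = i₀ then u (j + 1) i else u j i) ⬝ᵥ
        (fun i => if i = i₀ then u (j + l + 1) i else u (j + l) i) =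
      ∑ j ∈ Finset.range (d + 1 + 1), star (u j) ⬝ᵥ u (j + l) := by
  simp only [dotProduct]
  rw [Finset.sum_comm, Finset.sum_comm (s := Finset.range (d + 1 + 1))]
  refine Finset.sum_congr rfl fun i _ => ?_
  by_cases hi : i = i₀
  · subst hi
    rw [Finset.sum_range_succ' _ (d + 1)]
    simp only [Pi.star_apply, if_true, h0, star_zero, zero_mul, add_zero]
    refine Finset.sum_congr rfl fun j _ => ?_
    rw [add_right_comm]
  · rw [Finset.sum_range_succ _ (d + 1)]
    simp only [Pi.star_apply, hi, if_false, htop i hi, star_zero, zero_mul, add_zero]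

/-- A vector polynomial in `W` of degree `d` that has unit norm on the unit circle can be applied
with `d` uses of the controlled `W`. -/
theorem exists_realizes_vector_polynomial {n b : ℕ} {ι : Type} [Fintype ι] [DecidableEq ι] (i₀ : ι)
    {W : (QIndex n → Equiv.Perm (QIndex n)) → (QIndex n → QIndex n → BitString b) →
      Matrix (FullBasis n b Bool) (FullBasis n b Bool) ℂ} {q : ℕ}
    (hW : Realizes q fun f h => controlled i₀ (W f h)) (d : ℕ) (v : ℕ → ι → ℂ)
    (hv : ∀ j, d < j → v j = 0)
    (hc : ∀ l, ∑ j ∈ Finset.range (d + 1), star (v j) ⬝ᵥ v (j + l) = if l = 0 then 1 else 0) :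
    ∃ T : (QIndex n → Equiv.Perm (QIndex n)) → (QIndex n → QIndex n → BitString b) →
        Matrix (FullBasis n b Bool × ι) (FullBasis n b Bool × ι) ℂ,
      Realizes (q * d) T ∧ ∀ f h,
      T f h * stackAt i₀ (1 : Matrix (FullBasis n b Bool) (FullBasis n b Bool) ℂ) =
      stack fun i => ∑ j ∈ Finset.range (d + 1), v j i • W f h ^ j := by
  induction d generalizing v with
  | zero =>
    obtain ⟨R, hR⟩ := exists_unitary_mulVec_single i₀ (v 0) (by simpa using hc 0)
    refine ⟨_, Realizes.gate (onIndex_mem_unitaryGroup R.2), fun f h => ?_⟩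
    rw [onIndex_mul_stackAt]
    simp [hR]
  | succ d ih =>
    by_cases htop : v (d + 1) = 0
    -- A vanishing top coefficient lowers the degree at no cost.
    · obtain ⟨T, hT, hT'⟩ := ih v (fun j hj => by
        rcases Nat.lt_or_ge (d + 1) j with h | h
        · exact hv j h
        · rwa [show j = d + 1 by omega]) (fun l => by
          rw [← hc l, Finset.sum_range_succ _ (d + 1), htop, star_zero, zero_dotProduct, add_zero])
      refine ⟨T, hT.mono (Nat.mul_le_mul_left q (Nat.le_succ d)), fun f h => ?_⟩
      rw [hT']
      congr 1
      funext i
      rw [Finset.sum_range_succ _ (d + 1), htop]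
      simp
    · set w := v (d + 1) with hw
      set c : ℂ := ((√(∑ i, ‖w i‖ ^ 2) : ℝ) : ℂ) with hcdef
      have hpos : 0 < ∑ i, ‖w i‖ ^ 2 := by
        obtain ⟨i, hi⟩ := Function.ne_iff.1 htop
        exact Finset.sum_pos' (fun _ _ => by positivity)
          ⟨i, Finset.mem_univ _, by have := norm_pos_iff.2 hi; positivity⟩
      have hc0 : c ≠ 0 := Complex.ofReal_ne_zero.2 (Real.sqrt_pos.2 hpos).ne'
      have hcc : star w ⬝ᵥ w = c * c := by
        rw [hcdef, ← Complex.ofReal_mul, Real.mul_self_sqrt hpos.le, dotProduct]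
        push_cast
        exact Finset.sum_congr rfl fun i _ => Complex.conj_mul' _
      have hcstar : star c = c := Complex.conj_ofReal _
      -- `R` carries the axis `i₀` to the direction of the top coefficient, so that in rotated
      -- coordinates only coordinate `i₀` reaches degree `d + 1`.
      obtain ⟨R, hR⟩ := exists_unitary_mulVec_single i₀ (c⁻¹ • w) (by
        rw [star_smul, smul_dotProduct, dotProduct_smul, hcc, star_inv₀, hcstar, smul_eq_mul,
          smul_eq_mul]
        field_simp)
      have hRw : R.1 *ᵥ Pi.single i₀ c = w := by
        funext i
        rw [mulVec_single, Pi.smul_apply, col_apply, hR]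
        simp [mul_comm, hc0]
      have hRstar : R.1ᴴ ∈ unitaryGroup ι ℂ := (star R).2
      have hRR : R.1 * R.1ᴴ = 1 := mem_unitaryGroup_iff.1 R.2
      have hRR' : R.1ᴴ * R.1 = 1 := mem_unitaryGroup_iff'.1 R.2
      set u : ℕ → ι → ℂ := fun j => R.1ᴴ *ᵥ v j with hu
      have hutop : u (d + 1) = Pi.single i₀ c := by
        rw [hu]
        change R.1ᴴ *ᵥ w = _
        rw [← hRw, mulVec_mulVec, hRR', one_mulVec]
      have husupp : ∀ j, d + 1 < j → u j = 0 := by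
        intro j hj
        simp [hu, hv j hj]
      -- Orthogonality of the extreme coefficients frees coordinate `i₀` of its constant term, so it
      -- is divisible by the variable; the controlled `W` multiplies it back.
      have hu0 : u 0 i₀ = 0 := by
        have h1 := star_coeff_zero_dotProduct_coeff_top hv hc
        rw [← star_mulVec_dotProduct_mulVec hRstar] at h1
        change star (u 0) ⬝ᵥ u (d + 1) = 0 at h1
        rw [hutop, dotProduct_single] at h1
        simpa [hc0] using h1
      have hutop' : ∀ i, i ≠ i₀ → u (d + 1) i = 0 := by
        intro i hi
        rw [hutop, Pi.single_eq_of_ne hi]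
      obtain ⟨T, hT, hT'⟩ := ih (fun j i => if i = i₀ then u (j + 1) i else u j i)
        (fun j hj => by
          funext i
          by_cases hi : i = i₀
          · simp [hi, husupp (j + 1) (by omega)]
          · rcases Nat.lt_or_ge (d + 1) j with h | h
            · simp [hi, husupp j h]
            · simp [hi, show j = d + 1 by omega, hutop' i hi])
        (fun l => by
          rw [sum_autocorrelation_shift i₀ hu0 hutop', ← hc l]
          exact Finset.sum_congr rfl fun j _ => star_mulVec_dotProduct_mulVec hRstar _ _)
      refine ⟨_, (((Realizes.gate (onIndex_mem_unitaryGroup R.2)).mul hW).mul hT).mono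
        (by rw [Nat.mul_succ]; omega), fun f h => ?_⟩
      rw [Matrix.mul_assoc, Matrix.mul_assoc, hT', controlled, blockDiagonal_mul_stack,
        onIndex_mul_stack]
      have hstep : ∀ i, (if i = i₀ then W f h else 1) * ∑ j ∈ Finset.range (d + 1),
          (if i = i₀ then u (j + 1) i else u j i) • W f h ^ j =
          ∑ j ∈ Finset.range (d + 1 + 1), u j i • W f h ^ j := by
        intro i
        by_cases hi : i = i₀
        · subst hi
          rw [Finset.sum_range_succ' _ (d + 1)]
          simp only [if_true, hu0, zero_smul, add_zero, Finset.mul_sum, Matrix.mul_smul, pow_succ']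
        · rw [Finset.sum_range_succ _ (d + 1)]
          simp [hi, hutop' i hi]
      simp only [hstep]
      congr 1
      funext i
      simp only [Finset.smul_sum, smul_smul]
      rw [Finset.sum_comm]
      refine Finset.sum_congr rfl fun j _ => ?_
      rw [← Finset.sum_smul]
      congr 1
      have : R.1 *ᵥ u j = v j := by rw [hu, mulVec_mulVec, hRR, one_mulVec]
      exact congrFun this i

end

/-! ### The block encoding of the Hamiltonian -/

noncomputable section

open Matrix


theorem submatrix_mem_unitaryGroup {α β : Type} [Fintype α] [DecidableEq α] [Fintype β]
    [DecidableEq β] (e : α ≃ β) {U : Matrix β β ℂ} (hU : U ∈ unitaryGroup β ℂ) :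
    U.submatrix e e ∈ unitaryGroup α ℂ := by
  rw [mem_unitaryGroup_iff, star_eq_conjTranspose, conjTranspose_submatrix, submatrix_mul_equiv,
    ← star_eq_conjTranspose, mem_unitaryGroup_iff.1 hU, submatrix_one_equiv]

section BasisMap

variable {ι κ : Type} [Fintype ι] [DecidableEq ι]

theorem basisMap_mul_apply (σ : Equiv.Perm ι) (M : Matrix ι κ ℂ) (x : ι) (y : κ) :
    (basisMap σ * M) x y = M (σ.symm x) y := by
  rw [Matrix.mul_apply, Finset.sum_eq_single (σ.symm x)]
  · simp [basisMap]
  · intro z _ hz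
    have : x ≠ σ z := fun h => hz (by simp [h])
    simp [basisMap, this]
  · simp

theorem mul_basisMap_apply (σ : ι → ι) (M : Matrix κ ι ℂ) (x : κ) (y : ι) :
    (M * basisMap σ) x y = M x (σ y) := by
  rw [Matrix.mul_apply, Finset.sum_eq_single (σ y)]
  · simp [basisMap]
  · intro z _ hz
    simp [basisMap, hz]
  · simp

theorem conjTranspose_basisMap (σ : Equiv.Perm ι) : (basisMap σ)ᴴ = basisMap σ.symm := by
  ext x y
  have : (y = σ x) = (x = σ.symm y) := by
    rw [Equiv.eq_symm_apply, eq_comm (a := y)]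
  simp only [basisMap, conjTranspose_apply, of_apply, this]
  split_ifs <;> simp

theorem basisMap_mem_unitaryGroup (σ : Equiv.Perm ι) : basisMap σ ∈ unitaryGroup ι ℂ := by
  rw [mem_unitaryGroup_iff, star_eq_conjTranspose, conjTranspose_basisMap]
  ext x y
  rw [mul_basisMap_apply]
  simp [basisMap, one_apply]

end BasisMap

section Walk

variable {n b : ℕ}

/-- Splits off the second register. -/
def splitSecond (n b : ℕ) : FullBasis n b Bool ≃ (QIndex n × BitString b × Bool) × QIndex n where
  toFun x := ((x.1, x.2.2.1, x.2.2.2), x.2.1)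
  invFun x := (x.1.1, x.2, x.1.2.1, x.1.2.2)
  left_inv _ := rfl
  right_inv _ := rfl

/-- Splits off the flag qubit. -/
def splitFlag (n b : ℕ) : FullBasis n b Bool ≃ Bool × (QIndex n × QIndex n × BitString b) where
  toFun x := (x.2.2.2, x.1, x.2.1, x.2.2.1)
  invFun x := (x.2.1, x.2.2.1, x.2.2.2, x.1)
  left_inv _ := rfl
  right_inv _ := rfl

/-- Application of a matrix to the second register. -/
def onSecond (b : ℕ) (P : Matrix (QIndex n) (QIndex n) ℂ) :
    Matrix (FullBasis n b Bool) (FullBasis n b Bool) ℂ :=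
  (onIndex (QIndex n × BitString b × Bool) P).submatrix (splitSecond n b) (splitSecond n b)

theorem onSecond_mem_unitaryGroup {P : Matrix (QIndex n) (QIndex n) ℂ}
    (hP : P ∈ unitaryGroup (QIndex n) ℂ) :
    onSecond b P ∈ unitaryGroup (FullBasis n b Bool) ℂ :=
  submatrix_mem_unitaryGroup (splitSecond n b) (onIndex_mem_unitaryGroup hP)

/-- The reflection of the flag qubit with matrix element `c` at `|0⟩`. -/
def flagReflection (c : ℂ) : Matrix Bool Bool ℂ :=
  Matrix.of fun a a' => match a, a' with
    | false, false => c
    | true, true => -starRingEnd ℂ c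
    | _, _ => ((√(1 - ‖c‖ ^ 2) : ℝ) : ℂ)

theorem flagReflection_mem_unitaryGroup {c : ℂ} (hc : ‖c‖ ≤ 1) :
    flagReflection c ∈ unitaryGroup Bool ℂ := by
  have h : ((√(1 - ‖c‖ ^ 2) : ℝ) : ℂ) * ((√(1 - ‖c‖ ^ 2) : ℝ) : ℂ) =
      1 - c * starRingEnd ℂ c := by
    rw [← Complex.ofReal_mul, Real.mul_self_sqrt (by nlinarith [norm_nonneg c]), Complex.mul_conj']
    push_cast
    ring
  rw [mem_unitaryGroup_iff, star_eq_conjTranspose]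
  ext a a'
  rw [Matrix.mul_apply, Fintype.sum_bool]
  cases a <;> cases a' <;>
    simp only [flagReflection, of_apply, conjTranspose_apply, RCLike.star_def, map_neg,
      Complex.conj_conj, Complex.conj_ofReal, one_apply, reduceCtorEq, if_true, if_false, h] <;>
    ring

/-- The reflections for conjugate values are adjoint to each other. Applied to the entries at `(j,
k)` and `(k, j)`, this makes the swap built from them self-adjoint where the third register is zero.
-/
theorem conj_flagReflection_apply (c : ℂ) (a a' : Bool) :
    starRingEnd ℂ (flagReflection c a a') = flagReflection (starRingEnd ℂ c) a' a := by
  cases a <;> cases a' <;> simp [flagReflection, Complex.conj_ofReal]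

/-- The conjugate of the value that a bit string represents, divided by `Λ`; zero if the value is
not in the range of entries. -/
def normalizedValue (dec : BitString b → ℂ) (Λ : ℝ) (z : BitString b) : ℂ :=
  if ‖dec z‖ ≤ Λ then starRingEnd ℂ (dec z) / Λ else 0

theorem norm_normalizedValue_le (dec : BitString b → ℂ) {Λ : ℝ} (hΛ : 0 ≤ Λ) (z : BitString b) :
    ‖normalizedValue dec Λ z‖ ≤ 1 := by
  unfold normalizedValue
  split_ifs with h
  · rw [norm_div, RCLike.norm_conj, Complex.norm_real, Real.norm_of_nonneg hΛ]
    exact div_le_one_of_le₀ h hΛ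
  · simp

/-- The reflection of the flag qubit controlled by the value in the third register. -/
def valueRotation (n : ℕ) (dec : BitString b → ℂ) (Λ : ℝ) :
    Matrix (FullBasis n b Bool) (FullBasis n b Bool) ℂ :=
  (blockDiagonal fun x : QIndex n × QIndex n × BitString b =>
    flagReflection (normalizedValue dec Λ x.2.2)).submatrix (splitFlag n b) (splitFlag n b)

theorem valueRotation_mem_unitaryGroup (dec : BitString b → ℂ) {Λ : ℝ} (hΛ : 0 ≤ Λ) :
    valueRotation n dec Λ ∈ unitaryGroup (FullBasis n b Bool) ℂ :=
  submatrix_mem_unitaryGroup (splitFlag n b) (blockDiagonal_mem_unitaryGroup fun _ =>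
    flagReflection_mem_unitaryGroup (norm_normalizedValue_le dec hΛ _))

/-- The permutation of the basis performed by `O_F`. -/
def permF (b : ℕ) (Anc : Type) (f : QIndex n → Equiv.Perm (QIndex n)) :
    Equiv.Perm (FullBasis n b Anc) where
  toFun := fun (j, l, z, a) => (j, f j l, z, a)
  invFun := fun (j, k, z, a) => (j, (f j).symm k, z, a)
  left_inv _ := by simp
  right_inv _ := by simp

/-- The permutation of the basis performed by `O_H`. -/
def permH (Anc : Type) (h : QIndex n → QIndex n → BitString b) :
    Equiv.Perm (FullBasis n b Anc) where
  toFun := fun (j, k, z, a) => (j, k, fun i => xor (z i) (h j k i), a)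
  invFun := fun (j, k, z, a) => (j, k, fun i => xor (z i) (h j k i), a)
  left_inv _ := by simp
  right_inv _ := by simp

/-- The permutation of the basis that exchanges the first two registers. -/
def permSwap (n b : ℕ) : Equiv.Perm (FullBasis n b Bool) where
  toFun := fun (j, k, z, a) => (k, j, z, a)
  invFun := fun (j, k, z, a) => (k, j, z, a)
  left_inv _ := rfl
  right_inv _ := rfl

/-- The isometry that adds the initial states of the second, third and flag registers. -/
def walkEmbed (n b : ℕ) : Matrix (FullBasis n b Bool) (QIndex n) ℂ :=
  Matrix.of fun x j => if x = (j, 0, fun _ => false, false) then 1 else 0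

theorem mul_walkEmbed_apply {κ : Type} (M : Matrix κ (FullBasis n b Bool) ℂ) (x : κ)
    (j : QIndex n) : (M * walkEmbed n b) x j = M x (j, 0, fun _ => false, false) := by
  rw [Matrix.mul_apply, Finset.sum_eq_single (j, 0, fun _ => false, false)]
  · simp [walkEmbed]
  · intro z _ hz
    simp [walkEmbed, hz]
  · simp

theorem walkEmbed_isometry : (walkEmbed n b)ᴴ * walkEmbed n b = 1 := by
  ext i j
  rw [mul_walkEmbed_apply]
  by_cases h : i = j
  · simp [walkEmbed, h, one_apply]
  · simp [walkEmbed, one_apply, h, Ne.symm h]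

/-- The oracle-dependent swap that encodes the entries of the Hamiltonian. -/
def middle (dec : BitString b → ℂ) (Λ : ℝ) (h : QIndex n → QIndex n → BitString b) :
    Matrix (FullBasis n b Bool) (FullBasis n b Bool) ℂ :=
  basisMap (permSwap n b) *
    (basisMap (permH Bool h) * (valueRotation n dec Λ * basisMap (permH Bool h)))

theorem middle_apply (dec : BitString b → ℂ) (Λ : ℝ) (h : QIndex n → QIndex n → BitString b)
    (j k j' k' : QIndex n) (z z' : BitString b) (a a' : Bool) :
    middle dec Λ h (j, k, z, a) (j', k', z', a') =
      if k = j' ∧ j = k' ∧ z = z' then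
        flagReflection (normalizedValue dec Λ fun i => xor (z' i) (h j' k' i)) a a' else 0 := by
  rw [middle, basisMap_mul_apply, basisMap_mul_apply, mul_basisMap_apply]
  simp only [valueRotation, splitFlag, permSwap, permH, Equiv.coe_fn_symm_mk, Equiv.coe_fn_mk,
    submatrix_apply, blockDiagonal_apply, Prod.mk.injEq]
  by_cases h1 : k = j'
  · by_cases h2 : j = k'
    · subst h1 h2
      have : ((fun i => xor (z i) (h k j i)) = fun i => xor (z' i) (h k j i)) ↔ z = z' := by
        simp [funext_iff]
      by_cases hz : z = z'
      · simp [hz]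
      · simp [this, hz]
    · simp [h2]
  · simp [h1]

/-- The basis change of the walk: superposition of the column indices, then `O_F`. -/
def columnPrep (b : ℕ) (P : Matrix (QIndex n) (QIndex n) ℂ)
    (f : QIndex n → Equiv.Perm (QIndex n)) :
    Matrix (FullBasis n b Bool) (FullBasis n b Bool) ℂ :=
  basisMap (permF b Bool f) * onSecond b P

theorem columnPrep_mul_walkEmbed_apply (P : Matrix (QIndex n) (QIndex n) ℂ)
    (f : QIndex n → Equiv.Perm (QIndex n)) (j k j' : QIndex n) (z : BitString b) (a : Bool) :
    (columnPrep b P f * walkEmbed n b) (j, k, z, a) j' =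
      if j = j' ∧ (z = fun _ => false) ∧ a = false then P ((f j).symm k) 0 else 0 := by
  rw [mul_walkEmbed_apply, columnPrep, basisMap_mul_apply]
  simp [onSecond, onIndex, permF, splitSecond]

/-- The block encoding of the Hamiltonian. -/
def blockEncoding (P : Matrix (QIndex n) (QIndex n) ℂ) (dec : BitString b → ℂ) (Λ : ℝ)
    (f : QIndex n → Equiv.Perm (QIndex n)) (h : QIndex n → QIndex n → BitString b) :
    Matrix (FullBasis n b Bool) (FullBasis n b Bool) ℂ :=
  (columnPrep b P f)ᴴ * (middle dec Λ h * columnPrep b P f)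

theorem columnPrep_mem_unitaryGroup {P : Matrix (QIndex n) (QIndex n) ℂ}
    (hP : P ∈ unitaryGroup (QIndex n) ℂ) (f : QIndex n → Equiv.Perm (QIndex n)) :
    columnPrep b P f ∈ unitaryGroup (FullBasis n b Bool) ℂ :=
  mul_mem (basisMap_mem_unitaryGroup _) (onSecond_mem_unitaryGroup hP)

theorem middle_mem_unitaryGroup (dec : BitString b → ℂ) {Λ : ℝ} (hΛ : 0 ≤ Λ)
    (h : QIndex n → QIndex n → BitString b) :
    middle dec Λ h ∈ unitaryGroup (FullBasis n b Bool) ℂ :=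
  mul_mem (basisMap_mem_unitaryGroup _) (mul_mem (basisMap_mem_unitaryGroup _)
    (mul_mem (valueRotation_mem_unitaryGroup dec hΛ) (basisMap_mem_unitaryGroup _)))

theorem blockEncoding_mem_unitaryGroup {P : Matrix (QIndex n) (QIndex n) ℂ}
    (hP : P ∈ unitaryGroup (QIndex n) ℂ) (dec : BitString b → ℂ) {Λ : ℝ} (hΛ : 0 ≤ Λ)
    (f : QIndex n → Equiv.Perm (QIndex n)) (h : QIndex n → QIndex n → BitString b) :
    blockEncoding P dec Λ f h ∈ unitaryGroup (FullBasis n b Bool) ℂ :=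
  mul_mem (Unitary.star_mem (columnPrep_mem_unitaryGroup hP f))
    (mul_mem (middle_mem_unitaryGroup dec hΛ h) (columnPrep_mem_unitaryGroup hP f))

theorem norm_apply_le_maxNorm (H : Matrix (QIndex n) (QIndex n) ℂ) (j k : QIndex n) :
    ‖H j k‖ ≤ maxNorm H :=
  le_ciSup (f := fun p : QIndex n × QIndex n => ‖H p.1 p.2‖) (Set.finite_range _).bddAbove (j, k)

/-- The value is read before the registers are swapped, hence at the transposed position; the
conjugate in `normalizedValue` compensates for this. -/
theorem normalizedValue_eq {dec : BitString b → ℂ} {H : Matrix (QIndex n) (QIndex n) ℂ}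
    {h : QIndex n → QIndex n → BitString b} (hh : IsValueOracle dec H h) (hH : H.IsHermitian)
    (j k : QIndex n) : normalizedValue dec (maxNorm H) (h j k) = H k j / maxNorm H := by
  rw [normalizedValue, hh j k, if_pos (norm_apply_le_maxNorm H j k), ← hH.apply k j]
  rfl

/-- `middle` need not be Hermitian: for `z ≠ 0` the strings `z ⊕ h j k` may represent anything. The
prepared states have `z = 0`, where Hermiticity of `H` makes the two actions agree. -/
theorem middle_mul_eq_conjTranspose_mul {dec : BitString b → ℂ}
    {H : Matrix (QIndex n) (QIndex n) ℂ} {h : QIndex n → QIndex n → BitString b}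
    (hh : IsValueOracle dec H h) (hH : H.IsHermitian) (P : Matrix (QIndex n) (QIndex n) ℂ)
    (f : QIndex n → Equiv.Perm (QIndex n)) :
    middle dec (maxNorm H) h * (columnPrep b P f * walkEmbed n b) =
      (middle dec (maxNorm H) h)ᴴ * (columnPrep b P f * walkEmbed n b) := by
  ext ⟨j, k, z, a⟩ l
  rw [Matrix.mul_apply, Matrix.mul_apply]
  refine Finset.sum_congr rfl fun ⟨j', k', z', a'⟩ _ => ?_
  rw [columnPrep_mul_walkEmbed_apply]
  by_cases hz : z' = fun _ => false
  · congr 1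
    rw [conjTranspose_apply, middle_apply, middle_apply]
    by_cases hx : k = j' ∧ j = k' ∧ z = z'
    · obtain ⟨rfl, rfl, rfl⟩ := hx
      have hxor : ∀ x : BitString b, (fun i => xor (z i) (x i)) = x := by
        intro x
        simp [hz]
      rw [if_pos ⟨rfl, rfl, rfl⟩, if_pos ⟨rfl, rfl, rfl⟩, hxor, hxor, RCLike.star_def,
        conj_flagReflection_apply, normalizedValue_eq hh hH, normalizedValue_eq hh hH, map_div₀,
        Complex.conj_ofReal, ← hH.apply j k]
      rfl
    · rw [if_neg hx, if_neg, star_zero]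
      rintro ⟨rfl, rfl, rfl⟩
      exact hx ⟨rfl, rfl, rfl⟩
  · simp [hz]

theorem blockEncoding_mul_walkEmbed {dec : BitString b → ℂ}
    {H : Matrix (QIndex n) (QIndex n) ℂ} {h : QIndex n → QIndex n → BitString b}
    (hh : IsValueOracle dec H h) (hH : H.IsHermitian) (P : Matrix (QIndex n) (QIndex n) ℂ)
    (f : QIndex n → Equiv.Perm (QIndex n)) :
    (blockEncoding P dec (maxNorm H) f h)ᴴ * walkEmbed n b =
      blockEncoding P dec (maxNorm H) f h * walkEmbed n b := by
  rw [blockEncoding, conjTranspose_mul, conjTranspose_mul, conjTranspose_conjTranspose,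
    Matrix.mul_assoc, Matrix.mul_assoc, ← middle_mul_eq_conjTranspose_mul hh hH, Matrix.mul_assoc,
    Matrix.mul_assoc]

/-- The prepared states for `j` and `j'` overlap, through the swap, only at the basis pair `(j,
j')`. There the two amplitudes `1 / √N` and the flag amplitude `H j j' / Λ` multiply. -/
theorem conjTranspose_walkEmbed_mul_blockEncoding {dec : BitString b → ℂ}
    {H : Matrix (QIndex n) (QIndex n) ℂ} {h : QIndex n → QIndex n → BitString b} {d N : ℕ}
    (hh : IsValueOracle dec H h) (hH : H.IsHermitian) {P : Matrix (QIndex n) (QIndex n) ℂ}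
    (hP : ∀ l : QIndex n, P l 0 = if (l : ℕ) < d then ((√N : ℝ) : ℂ)⁻¹ else 0)
    {f : QIndex n → Equiv.Perm (QIndex n)} (hf : IsPositionOracle d H f) :
    (walkEmbed n b)ᴴ * (blockEncoding P dec (maxNorm H) f h * walkEmbed n b) =
      ((maxNorm H * N : ℝ) : ℂ)⁻¹ • H := by
  have hD : (walkEmbed n b)ᴴ * (blockEncoding P dec (maxNorm H) f h * walkEmbed n b) =
      (columnPrep b P f * walkEmbed n b)ᴴ *
        (middle dec (maxNorm H) h * (columnPrep b P f * walkEmbed n b)) := by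
    rw [blockEncoding, conjTranspose_mul]
    simp only [Matrix.mul_assoc]
  rw [hD]
  ext j j'
  have hsingle : ∀ (k : QIndex n) (z : BitString b) (a : Bool),
      (middle dec (maxNorm H) h * (columnPrep b P f * walkEmbed n b)) (j, k, z, a) j' =
      if k = j' ∧ z = fun _ => false then
        flagReflection (normalizedValue dec (maxNorm H) (h k j)) a false * P ((f k).symm j) 0
      else 0 := by
    intro k z a
    rw [Matrix.mul_apply, Finset.sum_eq_single (k, j, z, false)]
    · rw [columnPrep_mul_walkEmbed_apply, middle_apply, if_pos ⟨rfl, rfl, rfl⟩]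
      by_cases hz : z = fun _ => false
      · simp [hz]
      · simp [hz]
    · rintro ⟨j₁, k₁, z₁, a₁⟩ _ hne
      rw [columnPrep_mul_walkEmbed_apply, middle_apply]
      by_cases hx : k = j₁ ∧ j = k₁ ∧ z = z₁
      · obtain ⟨rfl, rfl, rfl⟩ := hx
        rw [if_neg (c := _ ∧ _ ∧ a₁ = false), mul_zero]
        rintro ⟨-, -, rfl⟩
        exact hne rfl
      · rw [if_neg hx, zero_mul]
    · simp
  rw [Matrix.mul_apply, Finset.sum_eq_single (j, j', (fun _ => false), false)]
  · rw [hsingle, conjTranspose_apply, columnPrep_mul_walkEmbed_apply, if_pos ⟨rfl, rfl, rfl⟩,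
      if_pos ⟨rfl, rfl⟩, hP, hP, normalizedValue_eq hh hH, Matrix.smul_apply]
    change _ * (H j j' / maxNorm H * _) = _
    -- Padding columns are harmless, as they carry a zero entry. For a nonzero entry, Hermiticity
    -- puts each label among the first `d` positions of the other's row, so both amplitudes are
    -- present.
    by_cases h0 : H j j' = 0
    · simp [h0]
    · have h0' : H j' j ≠ 0 := by
        rw [← hH.apply j' j]
        simpa using h0
      obtain ⟨l, hl, hl'⟩ := hf j j' h0
      obtain ⟨m, hm, hm'⟩ := hf j' j h0'
      have h1 : (f j).symm j' = l := by rw [← hl', Equiv.symm_apply_apply]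
      have h2 : (f j').symm j = m := by rw [← hm', Equiv.symm_apply_apply]
      have h3 : ((√N : ℝ) : ℂ)⁻¹ * ((√N : ℝ) : ℂ)⁻¹ = (N : ℂ)⁻¹ := by
        rw [← mul_inv, ← Complex.ofReal_mul, Real.mul_self_sqrt (Nat.cast_nonneg N)]
        simp
      rw [h1, h2, if_pos hl, if_pos hm, RCLike.star_def, map_inv₀, Complex.conj_ofReal,
        Complex.ofReal_mul, mul_inv, Complex.ofReal_natCast, ← h3, smul_eq_mul]
      ring
  · rintro ⟨j₁, k, z, a⟩ _ hne
    rw [conjTranspose_apply, columnPrep_mul_walkEmbed_apply]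
    by_cases hx : j₁ = j ∧ (z = fun _ => false) ∧ a = false
    · obtain ⟨rfl, rfl, rfl⟩ := hx
      rw [hsingle, if_neg (c := k = j' ∧ _), mul_zero]
      rintro ⟨rfl, -⟩
      exact hne rfl
    · rw [if_neg hx, star_zero, zero_mul]
  · simp

end Walk

end

/-! ### The quantum walk and functions of its cosine -/

noncomputable section

open Matrix


section Unitarity

variable {n b : ℕ}

theorem Step.toMatrix_mem_unitaryGroup {Anc : Type} [Fintype Anc] [DecidableEq Anc]
    (f : QIndex n → Equiv.Perm (QIndex n)) (h : QIndex n → QIndex n → BitString b)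
    (s : Step n b Anc) : s.toMatrix f h ∈ unitaryGroup (FullBasis n b Anc) ℂ := by
  cases s with
  | gate U => exact U.2
  | queryF => exact basisMap_mem_unitaryGroup (permF b Anc f)
  | queryFInv => exact basisMap_mem_unitaryGroup (permF b Anc f).symm
  | queryH => exact basisMap_mem_unitaryGroup (permH Anc h)

theorem runSteps_mem_unitaryGroup {Anc : Type} [Fintype Anc] [DecidableEq Anc]
    (f : QIndex n → Equiv.Perm (QIndex n)) (h : QIndex n → QIndex n → BitString b)
    (s : List (Step n b Anc)) : runSteps f h s ∈ unitaryGroup (FullBasis n b Anc) ℂ := by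
  induction s with
  | nil => exact one_mem _
  | cons x s ih =>
    rw [runSteps, List.foldl_cons, foldl_toMatrix_mul, mul_one]
    exact mul_mem ih (x.toMatrix_mem_unitaryGroup f h)

end Unitarity

section WalkOperator

variable {n b : ℕ} {ι : Type} [Fintype ι] [DecidableEq ι]

theorem uncontrolled_mul {Y : Type} [Fintype Y] [DecidableEq Y] (A B : Matrix Y Y ℂ) :
    uncontrolled ι (A * B) = uncontrolled ι A * uncontrolled ι B :=
  blockDiagonal_mul _ _

theorem uncontrolled_pow {Y : Type} [Fintype Y] [DecidableEq Y] (A : Matrix Y Y ℂ) (k : ℕ) :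
    uncontrolled ι A ^ k = uncontrolled ι (A ^ k) :=
  (blockDiagonal_pow _ _).symm

theorem uncontrolled_mem_unitaryGroup {Y : Type} [Fintype Y] [DecidableEq Y] {W : Matrix Y Y ℂ}
    (hW : W ∈ unitaryGroup Y ℂ) : uncontrolled ι W ∈ unitaryGroup (Y × ι) ℂ :=
  blockDiagonal_mem_unitaryGroup fun _ => hW

theorem controlled_mul {Y : Type} [Fintype Y] [DecidableEq Y] (i₀ : ι) (A B : Matrix Y Y ℂ) :
    controlled i₀ (A * B) = controlled i₀ A * controlled i₀ B := by
  rw [controlled, controlled, controlled, ← blockDiagonal_mul]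
  congr 1
  funext i
  split_ifs <;> simp

/-- Conjugating a controlled operator needs no control of the conjugating unitary. -/
theorem controlled_conj {Y : Type} [Fintype Y] [DecidableEq Y] (i₀ : ι) {V : Matrix Y Y ℂ}
    (A : Matrix Y Y ℂ) (V' : Matrix Y Y ℂ) (hV : V' * V = 1) :
    controlled i₀ (V' * (A * V)) =
      uncontrolled ι V' * (controlled i₀ A * uncontrolled ι V) := by
  rw [controlled, controlled, uncontrolled, uncontrolled, ← blockDiagonal_mul, ← blockDiagonal_mul]
  congr 1
  funext i
  split_ifs <;> simp [hV]

/-- The reflection about the range of an isometry. -/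
def reflectionAbout {Y Z : Type} [Fintype Z] [DecidableEq Y] (G : Matrix Y Z ℂ) : Matrix Y Y ℂ :=
  2 • (G * Gᴴ) - 1

theorem conjTranspose_reflectionAbout {Y Z : Type} [Fintype Z] [DecidableEq Y]
    (G : Matrix Y Z ℂ) : (reflectionAbout G)ᴴ = reflectionAbout G := by
  simp [reflectionAbout]

theorem reflectionAbout_mul {Y Z : Type} [Fintype Y] [Fintype Z] [DecidableEq Y] [DecidableEq Z]
    {G : Matrix Y Z ℂ} (hG : Gᴴ * G = 1) : reflectionAbout G * G = G := by
  rw [reflectionAbout, Matrix.sub_mul, Matrix.smul_mul, Matrix.mul_assoc, hG, Matrix.mul_one,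
    Matrix.one_mul, two_smul, add_sub_cancel_right]

theorem reflectionAbout_mem_unitaryGroup {Y Z : Type} [Fintype Y] [Fintype Z] [DecidableEq Y]
    [DecidableEq Z] {G : Matrix Y Z ℂ} (hG : Gᴴ * G = 1) :
    reflectionAbout G ∈ unitaryGroup Y ℂ := by
  rw [mem_unitaryGroup_iff, star_eq_conjTranspose, conjTranspose_reflectionAbout]
  conv_lhs => rw [reflectionAbout.eq_def (G := G)]
  rw [Matrix.mul_sub, Matrix.mul_smul, ← Matrix.mul_assoc]
  change 2 • (reflectionAbout G * G * Gᴴ) - reflectionAbout G * 1 = 1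
  rw [reflectionAbout_mul hG, Matrix.mul_one, reflectionAbout, sub_sub_cancel]

/-- The quantum walk. -/
def walk (P : Matrix (QIndex n) (QIndex n) ℂ) (dec : BitString b → ℂ) (Λ : ℝ)
    (f : QIndex n → Equiv.Perm (QIndex n)) (h : QIndex n → QIndex n → BitString b) :
    Matrix (FullBasis n b Bool) (FullBasis n b Bool) ℂ :=
  reflectionAbout (walkEmbed n b) * blockEncoding P dec Λ f h

theorem walk_mem_unitaryGroup {P : Matrix (QIndex n) (QIndex n) ℂ}
    (hP : P ∈ unitaryGroup (QIndex n) ℂ) (dec : BitString b → ℂ) {Λ : ℝ} (hΛ : 0 ≤ Λ)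
    (f : QIndex n → Equiv.Perm (QIndex n)) (h : QIndex n → QIndex n → BitString b) :
    walk P dec Λ f h ∈ unitaryGroup (FullBasis n b Bool) ℂ :=
  mul_mem (reflectionAbout_mem_unitaryGroup walkEmbed_isometry)
    (blockEncoding_mem_unitaryGroup hP dec hΛ f h)

theorem conjTranspose_basisMap_permH (h : QIndex n → QIndex n → BitString b) :
    (basisMap (permH Bool h))ᴴ = basisMap (permH Bool h) := by
  rw [conjTranspose_basisMap]
  rfl

theorem basisMap_permH_mul_self (h : QIndex n → QIndex n → BitString b) :
    basisMap (permH Bool h) * basisMap (permH Bool h) = 1 := by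
  have := mem_unitaryGroup_iff.1 (basisMap_mem_unitaryGroup (permH Bool h))
  rwa [star_eq_conjTranspose, conjTranspose_basisMap_permH] at this

theorem realizes_columnPrep {P : Matrix (QIndex n) (QIndex n) ℂ}
    (hP : P ∈ unitaryGroup (QIndex n) ℂ) :
    Realizes 1 fun (f : QIndex n → Equiv.Perm (QIndex n))
      (_ : QIndex n → QIndex n → BitString b) => uncontrolled ι (columnPrep b P f) := by
  simp only [columnPrep, uncontrolled_mul]
  exact Realizes.queryF.mul
    (Realizes.gate (uncontrolled_mem_unitaryGroup (onSecond_mem_unitaryGroup hP)))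

theorem realizes_conjTranspose_columnPrep {P : Matrix (QIndex n) (QIndex n) ℂ}
    (hP : P ∈ unitaryGroup (QIndex n) ℂ) :
    Realizes 1 fun (f : QIndex n → Equiv.Perm (QIndex n))
      (_ : QIndex n → QIndex n → BitString b) => uncontrolled ι (columnPrep b P f)ᴴ := by
  simp only [columnPrep, conjTranspose_mul, uncontrolled_mul, conjTranspose_basisMap]
  exact (Realizes.gate (uncontrolled_mem_unitaryGroup
    (Unitary.star_mem (onSecond_mem_unitaryGroup hP)))).mul Realizes.queryFInv

/-- Queries come without control. They occur in mutually inverse pairs around an inner operator, so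
controlling the oracle-independent gates is enough: on the other branches the pairs cancel. The four
queries are `O_F`, its inverse, and `O_H` twice. -/
theorem realizes_controlled_walk (i₀ : ι) {P : Matrix (QIndex n) (QIndex n) ℂ}
    (hP : P ∈ unitaryGroup (QIndex n) ℂ) (dec : BitString b → ℂ) {Λ : ℝ} (hΛ : 0 ≤ Λ) :
    Realizes 4 fun f h => controlled i₀ (walk P dec Λ f h) := by
  have hmid : Realizes (n := n) (b := b) 2 fun _ h => controlled i₀ (middle dec Λ h) := by
    simp only [middle, controlled_mul i₀ (basisMap (permSwap n b)),
      fun h => controlled_conj i₀ (valueRotation n dec Λ) _ (basisMap_permH_mul_self h)]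
    exact (Realizes.gate (controlled_mem_unitaryGroup i₀ (basisMap_mem_unitaryGroup _))).mul
      (Realizes.queryH.mul ((Realizes.gate (controlled_mem_unitaryGroup i₀
        (valueRotation_mem_unitaryGroup dec hΛ))).mul Realizes.queryH))
  simp only [walk, controlled_mul i₀ (reflectionAbout _), blockEncoding]
  have hcol : ∀ f, (columnPrep b P f)ᴴ * columnPrep b P f = 1 := fun f =>
    mem_unitaryGroup_iff'.1 (columnPrep_mem_unitaryGroup hP f)
  simp only [fun f h => controlled_conj i₀ (middle dec Λ h) _ (hcol f)]
  exact ((Realizes.gate (controlled_mem_unitaryGroup i₀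
    (reflectionAbout_mem_unitaryGroup walkEmbed_isometry))).mul
      ((realizes_conjTranspose_columnPrep hP).mul (hmid.mul (realizes_columnPrep hP))))

theorem realizes_conjTranspose_walk {P : Matrix (QIndex n) (QIndex n) ℂ}
    (hP : P ∈ unitaryGroup (QIndex n) ℂ) (dec : BitString b → ℂ) {Λ : ℝ} (hΛ : 0 ≤ Λ) :
    Realizes 4 fun f h => uncontrolled ι (walk P dec Λ f h)ᴴ := by
  have hmid : Realizes (n := n) (b := b) 2 fun _ h => uncontrolled ι (middle dec Λ h)ᴴ := by
    simp only [middle, conjTranspose_mul, conjTranspose_basisMap_permH, uncontrolled_mul]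
    exact ((Realizes.queryH.mul (Realizes.gate (uncontrolled_mem_unitaryGroup
      (Unitary.star_mem (valueRotation_mem_unitaryGroup dec hΛ))))).mul Realizes.queryH).mul
      (Realizes.gate (uncontrolled_mem_unitaryGroup
        (Unitary.star_mem (basisMap_mem_unitaryGroup _))))
  simp only [walk, blockEncoding, conjTranspose_mul, conjTranspose_conjTranspose,
    conjTranspose_reflectionAbout, uncontrolled_mul]
  exact (((realizes_conjTranspose_columnPrep hP).mul hmid).mul (realizes_columnPrep hP)).mul
    (Realizes.gate (uncontrolled_mem_unitaryGroup
      (reflectionAbout_mem_unitaryGroup walkEmbed_isometry)))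

/-- The cosine of the walk restricts to the block-encoded matrix. -/
theorem walk_add_conjTranspose_mul {Y Z : Type} [Fintype Y] [Fintype Z] [DecidableEq Y]
    [DecidableEq Z] {G : Matrix Y Z ℂ} (hG : Gᴴ * G = 1) {U : Matrix Y Y ℂ}
    (hU : Uᴴ * G = U * G) :
    ((2⁻¹ : ℂ) • (reflectionAbout G * U + (reflectionAbout G * U)ᴴ)) * G = G * (Gᴴ * (U * G)) := by
  -- The reflection fixes `G`, so the adjoint of the walk sends `G` to `Uᴴ * G = U * G`. The average
  -- is then half of reflection plus identity, the projection onto the range of `G`, applied to `U *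
  -- G`.
  rw [conjTranspose_mul, conjTranspose_reflectionAbout, Matrix.smul_mul, Matrix.add_mul,
    Matrix.mul_assoc Uᴴ, reflectionAbout_mul hG, hU, Matrix.mul_assoc]
  conv_lhs => rw [reflectionAbout.eq_def (G := G)]
  rw [Matrix.sub_mul, Matrix.one_mul, sub_add_cancel, Matrix.smul_mul, Matrix.mul_assoc,
    ← Nat.cast_smul_eq_nsmul ℂ, smul_smul]
  simp

/-- At the unitary `W`, `cosNumerator` evaluates to `W` times the cosine `c` of `W`, which commutes
with `W`. Thus `W ^ M` factors out and cancels, and the intertwining relation passes from `c` to its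
powers. -/
theorem aeval_expCos_mul {Y Z : Type} [Fintype Y] [Fintype Z] [DecidableEq Y] [DecidableEq Z]
    {G : Matrix Y Z ℂ} {W : Matrix Y Y ℂ} (hW : W ∈ unitaryGroup Y ℂ) {X : Matrix Z Z ℂ}
    (hX : ((2⁻¹ : ℂ) • (W + Wᴴ)) * G = G * X) (a : ℂ) (M : ℕ) :
    Wᴴ ^ M * (Polynomial.aeval W (expCos a M) * G) =
      G * ∑ m ∈ Finset.range (M + 1), (a ^ m / m.factorial) • X ^ m := by
  have hWW : W * Wᴴ = 1 := mem_unitaryGroup_iff.1 hW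
  have hWW' : Wᴴ * W = 1 := mem_unitaryGroup_iff'.1 hW
  have hcomm : Commute Wᴴ W := hWW'.trans hWW.symm
  set c : Matrix Y Y ℂ := (2⁻¹ : ℂ) • (W + Wᴴ) with hc
  have hcW : Commute W c := ((Commute.refl W).add_right hcomm.symm).smul_right _
  have hcos : Polynomial.aeval W cosNumerator = W * c := by
    simp only [cosNumerator, map_mul, map_add, map_one, map_pow, Polynomial.aeval_C,
      Polynomial.aeval_X, hc, Matrix.mul_smul, mul_add, hWW, Algebra.algebraMap_eq_smul_one,
      smul_mul_assoc, one_mul]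
    rw [sq, add_comm, smul_add]
  have hpow : ∀ m, c ^ m * G = G * X ^ m := by
    intro m
    induction m with
    | zero => simp
    | succ m ih =>
      rw [pow_succ, Matrix.mul_assoc, hX, ← Matrix.mul_assoc, ih, Matrix.mul_assoc, pow_succ]
  have hcancel : Wᴴ ^ M * W ^ M = 1 := by rw [← hcomm.mul_pow, hWW', one_pow]
  have hterm : ∀ m ∈ Finset.range (M + 1),
      Polynomial.aeval W (cosNumerator ^ m * Polynomial.X ^ (M - m)) = W ^ M * c ^ m := by
    intro m hm
    have hm : m ≤ M := Nat.lt_succ_iff.1 (Finset.mem_range.1 hm)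
    rw [map_mul, map_pow, map_pow, hcos, Polynomial.aeval_X, hcW.mul_pow, mul_assoc,
      ((hcW.pow_pow _ _).eq).symm, ← mul_assoc, ← pow_add, Nat.add_sub_cancel' hm]
  rw [expCos, map_sum, Matrix.sum_mul, Matrix.mul_sum, Matrix.mul_sum]
  refine Finset.sum_congr rfl fun m hm => ?_
  rw [map_mul, hterm m hm, Polynomial.aeval_C, Algebra.algebraMap_eq_smul_one, smul_mul_assoc,
    one_mul, Matrix.smul_mul, Matrix.mul_smul, Matrix.mul_smul, Matrix.mul_assoc, hpow,
    ← Matrix.mul_assoc, hcancel, Matrix.one_mul]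

end WalkOperator

end

/-! ### Norm estimates: exponential remainders, isometries and the size of the Hamiltonian -/

noncomputable section

open Matrix
open scoped Matrix.Norms.L2Operator


theorem norm_exp_sub_sum_le {𝔸 : Type*} [NormedRing 𝔸] [NormedAlgebra ℂ 𝔸] [CompleteSpace 𝔸]
    (x : 𝔸) (M : ℕ) :
    ‖NormedSpace.exp x - ∑ m ∈ Finset.range (M + 1), (m.factorial⁻¹ : ℂ) • x ^ m‖ ≤
      Real.exp ‖x‖ - ∑ m ∈ Finset.range (M + 1), ‖x‖ ^ m / m.factorial := by
  have hx := NormedSpace.exp_series_hasSum_exp' (𝕂 := ℂ) x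
  have hr : HasSum (fun m : ℕ => ‖x‖ ^ m / m.factorial) (Real.exp ‖x‖) := by
    rw [Real.exp_eq_exp_ℝ]
    exact NormedSpace.expSeries_div_hasSum_exp ‖x‖
  have hx' := (hasSum_nat_add_iff' (M + 1)).2 hx
  have hr' := (hasSum_nat_add_iff' (M + 1)).2 hr
  rw [← hx'.tsum_eq]
  refine tsum_of_norm_bounded hr' fun m => ?_
  rw [norm_smul, norm_inv, Complex.norm_natCast, div_eq_inv_mul]
  gcongr
  exact norm_pow_le' x (by omega)

/-- Each term of the tail has degree above `M`, so inserting `2 ^ (degree - M) ≥ 1` turns it into a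
term of the series at `2 * x`. -/
theorem exp_sub_sum_le {x : ℝ} (hx : 0 ≤ x) (M : ℕ) :
    Real.exp x - ∑ m ∈ Finset.range (M + 1), x ^ m / m.factorial ≤
      2⁻¹ ^ M * Real.exp (2 * x) := by
  have hr : ∀ y : ℝ, HasSum (fun m : ℕ => y ^ m / m.factorial) (Real.exp y) := by
    intro y
    rw [Real.exp_eq_exp_ℝ]
    exact NormedSpace.expSeries_div_hasSum_exp y
  have h1 := (hasSum_nat_add_iff' (M + 1)).2 (hr x)
  have h2 := ((hasSum_nat_add_iff' (M + 1)).2 (hr (2 * x))).mul_left ((2⁻¹ : ℝ) ^ M)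
  refine (hasSum_le (fun m => ?_) h1 h2).trans ?_
  · have h3 : (1 : ℝ) ≤ 2⁻¹ ^ M * 2 ^ (m + (M + 1)) := by
      rw [inv_pow, ← div_eq_inv_mul, le_div_iff₀ (by positivity), one_mul]
      exact pow_le_pow_right₀ (by norm_num) (by omega)
    have h4 : 0 ≤ x ^ (m + (M + 1)) / (m + (M + 1)).factorial := by positivity
    refine (le_mul_of_one_le_left h4 h3).trans (le_of_eq ?_)
    rw [mul_pow]
    ring
  · have h5 : 0 ≤ ∑ m ∈ Finset.range (M + 1), (2 * x) ^ m / m.factorial := by positivity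
    exact mul_le_mul_of_nonneg_left (by linarith) (by positivity)

section Isometry

variable {Y Z : Type} [Fintype Y] [Fintype Z] [DecidableEq Z]

theorem l2_opNorm_one_le : ‖(1 : Matrix Z Z ℂ)‖ ≤ 1 := by
  rw [← diagonal_one, l2_opNorm_diagonal, pi_norm_le_iff_of_nonneg zero_le_one]
  simp

theorem l2_opNorm_le_one_of_isometry {A : Matrix Y Z ℂ} (hA : Aᴴ * A = 1) : ‖A‖ ≤ 1 := by
  have h := l2_opNorm_conjTranspose_mul_self A
  rw [hA] at h
  have := l2_opNorm_one_le (Z := Z)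
  nlinarith [norm_nonneg A]

/-- For isometries, `(A - B)ᴴ * (A - B)` is `1 - Bᴴ * A` plus its adjoint. Control of the overlap
alone therefore bounds the components outside the target subspace too. -/
theorem l2_opNorm_sub_sq_le_of_isometry {A B : Matrix Y Z ℂ} (hA : Aᴴ * A = 1)
    (hB : Bᴴ * B = 1) : ‖A - B‖ ^ 2 ≤ 2 * ‖1 - Bᴴ * A‖ := by
  have h : (A - B)ᴴ * (A - B) = (1 - Bᴴ * A) + (1 - Bᴴ * A)ᴴ := by
    rw [conjTranspose_sub, Matrix.sub_mul, Matrix.mul_sub, Matrix.mul_sub, hA, hB,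
      conjTranspose_sub, conjTranspose_mul, conjTranspose_conjTranspose, conjTranspose_one]
    abel
  rw [sq, ← l2_opNorm_conjTranspose_mul_self, h, two_mul]
  refine (norm_add_le _ _).trans ?_
  rw [l2_opNorm_conjTranspose]

end Isometry

theorem evolution_unitary {n : ℕ} {H : Matrix (QIndex n) (QIndex n) ℂ} (hH : H.IsHermitian)
    (t : ℝ) : (evolution H t)ᴴ * evolution H t = 1 := by
  rw [evolution, ← exp_conjTranspose, conjTranspose_smul, hH.eq]
  have : star (-(Complex.I * (t : ℂ))) = -(-(Complex.I * (t : ℂ))) := by simp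
  rw [this, neg_smul, Matrix.exp_neg]
  exact Matrix.nonsing_inv_mul _ ((Matrix.isUnit_iff_isUnit_det _).1 (Matrix.isUnit_exp _))

/-- A unitary matrix whose first column is the uniform superposition of the first `d` labels. -/
theorem exists_uniform_column (n : ℕ) {d : ℕ} (hd : 0 < d) :
    ∃ N : ℕ, 0 < N ∧ N ≤ d ∧ ∃ P ∈ unitaryGroup (QIndex n) ℂ,
      ∀ l : QIndex n, P l 0 = if (l : ℕ) < d then ((√N : ℝ) : ℂ)⁻¹ else 0 := by
  -- `d` may exceed the number of labels, so the normalization is the number `N` of labels below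
  -- `d`, not `d` itself.
  set s : Finset (QIndex n) := Finset.univ.filter fun l => (l : ℕ) < d with hs
  have hpos : 0 < s.card := Finset.card_pos.2 ⟨0, by simpa [hs] using hd⟩
  have hle : s.card ≤ d := by
    have := Finset.card_le_card_of_injOn (s := s) (t := Finset.range d) Fin.val
      (fun l hl => by simpa [hs] using hl) (Fin.val_injective.injOn)
    simpa using this
  obtain ⟨P, hP⟩ := exists_unitary_mulVec_single (0 : QIndex n)
    (fun l => if (l : ℕ) < d then ((√s.card : ℝ) : ℂ)⁻¹ else 0) (by
      have h : ∀ l : QIndex n,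
          star (fun l : QIndex n => if (l : ℕ) < d then ((√s.card : ℝ) : ℂ)⁻¹ else 0) l *
          (if (l : ℕ) < d then ((√s.card : ℝ) : ℂ)⁻¹ else 0) =
          if (l : ℕ) < d then (s.card : ℂ)⁻¹ else 0 := by
        intro l
        rw [Pi.star_apply]
        split_ifs
        · rw [RCLike.star_def, map_inv₀, Complex.conj_ofReal, ← mul_inv, ← Complex.ofReal_mul,
            Real.mul_self_sqrt (Nat.cast_nonneg _), Complex.ofReal_natCast]
        · simp
      rw [dotProduct, Finset.sum_congr rfl fun l _ => h l, ← Finset.sum_filter, Finset.sum_const,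
        nsmul_eq_mul]
      exact mul_inv_cancel₀ (Nat.cast_ne_zero.2 hpos.ne'))
  exact ⟨s.card, hpos, hle, P.1, P.2, hP⟩

theorem embed_isometry {n b : ℕ} (A : QueryAlgorithm n b) : A.embedᴴ * A.embed = 1 := by
  ext i j
  rw [Matrix.mul_apply, Finset.sum_eq_single (i, 0, (fun _ => false), A.start)]
  · simp [QueryAlgorithm.embed, one_apply]
  · intro x _ hx
    simp [QueryAlgorithm.embed, hx]
  · simp

section Block

variable {n b : ℕ} {dec : BitString b → ℂ} {H : Matrix (QIndex n) (QIndex n) ℂ}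
  {f : QIndex n → Equiv.Perm (QIndex n)} {h : QIndex n → QIndex n → BitString b} {d N : ℕ}

/-- The matrix is a compression of a unitary, by the block encoding. -/
theorem norm_smul_hamiltonian_le (hH : H.IsHermitian) (hf : IsPositionOracle d H f)
    (hh : IsValueOracle dec H h) {P : Matrix (QIndex n) (QIndex n) ℂ}
    (hPu : P ∈ unitaryGroup (QIndex n) ℂ)
    (hP : ∀ l : QIndex n, P l 0 = if (l : ℕ) < d then ((√N : ℝ) : ℂ)⁻¹ else 0) :
    ‖((maxNorm H * N : ℝ) : ℂ)⁻¹ • H‖ ≤ 1 := by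
  have hΛ : 0 ≤ maxNorm H := (norm_nonneg _).trans (norm_apply_le_maxNorm H 0 0)
  have hU : ‖blockEncoding P dec (maxNorm H) f h‖ ≤ 1 := l2_opNorm_le_one_of_isometry
    (mem_unitaryGroup_iff'.1 (blockEncoding_mem_unitaryGroup hPu dec hΛ f h))
  have hG : ‖walkEmbed n b‖ ≤ 1 := l2_opNorm_le_one_of_isometry walkEmbed_isometry
  have hG' : ‖(walkEmbed n b)ᴴ‖ ≤ 1 := by rwa [l2_opNorm_conjTranspose]
  rw [← conjTranspose_walkEmbed_mul_blockEncoding hh hH hP hf]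
  refine (l2_opNorm_mul _ _).trans (mul_le_one₀ hG' (norm_nonneg _) ?_)
  exact (l2_opNorm_mul _ _).trans (mul_le_one₀ hU (norm_nonneg _) hG)

theorem norm_hamiltonian_le (hH : H.IsHermitian) (hf : IsPositionOracle d H f)
    (hh : IsValueOracle dec H h) : ‖H‖ ≤ maxNorm H * d := by
  have hΛ : 0 ≤ maxNorm H := (norm_nonneg _).trans (norm_apply_le_maxNorm H 0 0)
  by_cases h0 : H = 0
  · rw [h0, norm_zero]
    rw [h0] at hΛ
    positivity
  obtain ⟨j, k, hjk⟩ : ∃ j k, H j k ≠ 0 := by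
    by_contra! hne
    exact h0 (by ext j k; exact hne j k)
  have hd : 0 < d := by
    obtain ⟨l, hl, -⟩ := hf j k hjk
    omega
  have hΛ' : 0 < maxNorm H := (norm_pos_iff.2 hjk).trans_le (norm_apply_le_maxNorm H j k)
  obtain ⟨N, hN, hNd, P, hPu, hP⟩ := exists_uniform_column n hd
  have h1 := norm_smul_hamiltonian_le hH hf hh hPu hP
  have hN' : (0 : ℝ) < N := by exact_mod_cast hN
  rw [norm_smul, norm_inv, Complex.norm_real, Real.norm_of_nonneg (by positivity),
    inv_mul_le_iff₀ (by positivity), mul_one] at h1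
  refine h1.trans (mul_le_mul_of_nonneg_left ?_ hΛ)
  exact_mod_cast hNd

theorem norm_evolution_sub_one_le (hH : H.IsHermitian) (hf : IsPositionOracle d H f)
    (hh : IsValueOracle dec H h) {t : ℝ} (ht : 0 ≤ t) (hτ : t * maxNorm H * d ≤ 1) :
    ‖1 - evolution H t‖ ≤ 2 * (t * maxNorm H * d) := by
  have h1 := norm_exp_sub_sum_le ((-(Complex.I * (t : ℂ))) • H) 0
  have h2 : ‖(-(Complex.I * (t : ℂ))) • H‖ ≤ t * maxNorm H * d := by
    rw [norm_smul, norm_neg, norm_mul, Complex.norm_I, one_mul, Complex.norm_real,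
      Real.norm_of_nonneg ht, mul_assoc]
    exact mul_le_mul_of_nonneg_left (norm_hamiltonian_le hH hf hh) ht
  simp only [zero_add, Finset.range_one, Finset.sum_singleton, pow_zero, Nat.factorial_zero,
    Nat.cast_one, inv_one, one_smul, div_one] at h1
  rw [norm_sub_rev]
  refine h1.trans ?_
  have h3 := Real.abs_exp_sub_one_le (x := ‖(-(Complex.I * (t : ℂ))) • H‖)
    (by rw [abs_norm]; linarith)
  rw [abs_norm] at h3
  have h4 := le_abs_self (Real.exp ‖(-(Complex.I * (t : ℂ))) • H‖ - 1)
  linarith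

end Block

end

/-! ### Assembly of the algorithm and the query count -/

noncomputable section

open Matrix
open scoped Matrix.Norms.L2Operator


theorem stackAt_one_mul {ι Y Z : Type} [Fintype ι] [DecidableEq ι] [Fintype Y] [DecidableEq Y]
    (i₀ : ι) (G : Matrix Y Z ℂ) : stackAt i₀ (1 : Matrix Y Y ℂ) * G = stackAt i₀ G := by
  rw [stackAt, stack_mul, stackAt]
  congr 1
  funext i
  split_ifs <;> simp

theorem one_sub_inv_sqrt_le {δ : ℝ} (hδ : 0 ≤ δ) :
    0 ≤ 1 - (√(1 + 2 * δ))⁻¹ ∧ 1 - (√(1 + 2 * δ))⁻¹ ≤ δ := by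
  have h1 : 1 ≤ √(1 + 2 * δ) := Real.one_le_sqrt.2 (by linarith)
  have h2 : √(1 + 2 * δ) ≤ 1 + δ := Real.sqrt_le_iff.2 ⟨by linarith, by nlinarith⟩
  refine ⟨sub_nonneg.2 (inv_le_one_of_one_le₀ h1), ?_⟩
  have h3 : (1 + δ)⁻¹ ≤ (√(1 + 2 * δ))⁻¹ := inv_anti₀ (by linarith) h2
  have h4 : 1 - δ ≤ (1 + δ)⁻¹ := by
    rw [← one_div, le_div_iff₀ (by linarith)]
    nlinarith
  linarith

/-- The scaled Taylor polynomial of the exponential of the walk's cosine, as a component of an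
operator that can be applied with `12 M` queries. -/
theorem exists_realizes_taylor {n b : ℕ} {P : Matrix (QIndex n) (QIndex n) ℂ}
    (hP : P ∈ unitaryGroup (QIndex n) ℂ) (dec : BitString b → ℂ) {Λ : ℝ} (hΛ : 0 ≤ Λ) {a : ℂ}
    (ha : starRingEnd ℂ a = -a) (M : ℕ) {δ : ℝ} (hδ : 2⁻¹ ^ M * Real.exp (4 * ‖a‖) ≤ δ) :
    ∃ T : (QIndex n → Equiv.Perm (QIndex n)) → (QIndex n → QIndex n → BitString b) →
        Matrix (FullBasis n b Bool × Option (Option (Fin (2 * M))))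
          (FullBasis n b Bool × Option (Option (Fin (2 * M)))) ℂ,
      Realizes (12 * M) T ∧ ∀ f h, ∃ B : Option (Option (Fin (2 * M))) →
        Matrix (FullBasis n b Bool) (FullBasis n b Bool) ℂ,
      T f h * stackAt (none : Option (Option (Fin (2 * M))))
        (1 : Matrix (FullBasis n b Bool) (FullBasis n b Bool) ℂ) = stack B ∧
      B none = (((√(1 + 2 * δ))⁻¹ : ℝ) : ℂ) •
        ((walk P dec Λ f h)ᴴ ^ M * Polynomial.aeval (walk P dec Λ f h) (expCos a M)) := by
  have hδ0 : 0 ≤ δ := le_trans (by positivity) hδ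
  -- The autocorrelations of `expCos a M` sum to at most `1 + 2 * δ` and are quadratic in the
  -- coefficients; this scaling brings the sum down to one.
  set ρ : ℝ := (√(1 + 2 * δ))⁻¹ with hρ
  have hρ2 : ρ * ρ = (1 + 2 * δ)⁻¹ := by
    rw [hρ, ← mul_inv, Real.mul_self_sqrt (by linarith)]
  have hscale : ∀ l, ∑ j ∈ Finset.range (2 * M + 1),
      starRingEnd ℂ ((ρ : ℂ) * (expCos a M).coeff j) * ((ρ : ℂ) * (expCos a M).coeff (j + l)) =
      ((ρ * ρ : ℝ) : ℂ) * ∑ j ∈ Finset.range (2 * M + 1),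
        starRingEnd ℂ ((expCos a M).coeff j) * (expCos a M).coeff (j + l) := by
    intro l
    rw [Finset.mul_sum]
    refine Finset.sum_congr rfl fun j _ => ?_
    rw [map_mul, Complex.conj_ofReal, Complex.ofReal_mul]
    ring
  have hnorm : ‖((ρ * ρ : ℝ) : ℂ)‖ = (1 + 2 * δ)⁻¹ := by
    rw [Complex.norm_real, hρ2, Real.norm_of_nonneg (by positivity)]
  obtain ⟨v, hv0, hv, hvc⟩ := exists_unit_completion (2 * M)
    (fun j => (ρ : ℂ) * (expCos a M).coeff j)
    (fun j hj => by
      rw [Polynomial.coeff_eq_zero_of_natDegree_lt ((natDegree_expCos_le a M).trans_lt hj),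
        mul_zero])
    (by
      have h0 := hscale 0
      simp only [add_zero] at h0
      rw [h0]
      simp only [hscale, norm_mul, hnorm, ← Finset.mul_sum]
      have h1 := sum_norm_autocorrelation_expCos_le ha M
      rw [mul_left_comm, ← mul_add, inv_mul_le_iff₀ (by positivity), mul_one]
      linarith)
  obtain ⟨T, hT, hT'⟩ := exists_realizes_vector_polynomial none
    (realizes_controlled_walk none hP dec hΛ) (2 * M) v hv hvc
  -- The count is `4 * (2 * M)` for the controlled walks and `4 * M` for the inverse walks.
  refine ⟨_, (((realizes_conjTranspose_walk hP dec hΛ).pow M).mul hT).mono (by omega),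
    fun f h => ⟨fun i => (walk P dec Λ f h)ᴴ ^ M *
      ∑ j ∈ Finset.range (2 * M + 1), v j i • walk P dec Λ f h ^ j, ?_, ?_⟩⟩
  · rw [Matrix.mul_assoc, hT', uncontrolled_pow, uncontrolled, blockDiagonal_mul_stack]
  · rw [Polynomial.aeval_eq_sum_range' (Nat.lt_succ_of_le (natDegree_expCos_le a M))]
    simp only [hv0, Finset.mul_sum, Finset.smul_sum, Matrix.mul_smul, smul_smul]

theorem conjTranspose_stackAt_mul_stack {ι Y Z X : Type} [Fintype ι] [DecidableEq ι] [Fintype Y]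
    [DecidableEq Y] (i₀ : ι) (G : Matrix Y Z ℂ) (B : ι → Matrix Y X ℂ) :
    (stackAt i₀ G)ᴴ * stack B = Gᴴ * B i₀ := by
  rw [stackAt, conjTranspose_stack_mul_stack, Finset.sum_eq_single i₀]
  · rw [if_pos rfl]
  · intro i _ hi
    rw [if_neg hi, conjTranspose_zero, Matrix.zero_mul]
  · simp

theorem stackAt_isometry {ι Y Z : Type} [Fintype ι] [DecidableEq ι] [Fintype Y] [DecidableEq Y]
    [DecidableEq Z] (i₀ : ι) {G : Matrix Y Z ℂ} (hG : Gᴴ * G = 1) :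
    (stackAt i₀ G)ᴴ * stackAt i₀ G = 1 := by
  conv_lhs => rw [stackAt.eq_def (G := G)]
  change (stackAt i₀ G)ᴴ * stack _ = 1
  rw [conjTranspose_stackAt_mul_stack, if_pos rfl, hG]

theorem l2_opNorm_submatrix_equiv {X Y Z : Type} [Fintype X] [Fintype Y] [Fintype Z]
    [DecidableEq Z] (e : X ≃ Y) (A : Matrix Y Z ℂ) : ‖A.submatrix e id‖ = ‖A‖ := by
  have h : ‖A.submatrix e id‖ * ‖A.submatrix e id‖ = ‖A‖ * ‖A‖ := by
    rw [← l2_opNorm_conjTranspose_mul_self, ← l2_opNorm_conjTranspose_mul_self,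
      conjTranspose_submatrix, submatrix_mul_equiv, submatrix_id_id]
  exact (mul_self_inj (norm_nonneg _) (norm_nonneg _)).1 h

section Realizes

variable {n b q : ℕ} {ι : Type} [Fintype ι] [DecidableEq ι]
  {T : (QIndex n → Equiv.Perm (QIndex n)) → (QIndex n → QIndex n → BitString b) →
    Matrix (FullBasis n b Bool × ι) (FullBasis n b Bool × ι) ℂ}

theorem Realizes.conjTranspose_mul_self (hT : Realizes q T) (f : QIndex n → Equiv.Perm (QIndex n))
    (h : QIndex n → QIndex n → BitString b) : (T f h)ᴴ * T f h = 1 := by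
  obtain ⟨s, -, hs⟩ := hT
  have h1 := submatrix_mem_unitaryGroup (splitIndex n b ι).symm (runSteps_mem_unitaryGroup f h s)
  rw [hs, submatrix_submatrix, Equiv.self_comp_symm, submatrix_id_id] at h1
  exact mem_unitaryGroup_iff'.1 h1

theorem Realizes.exists_algorithm (hT : Realizes q T) (i₀ : ι) :
    ∃ A : QueryAlgorithm n b, A.queryCount ≤ q ∧ ∀ f h V ε,
      ‖T f h * stackAt i₀ (walkEmbed n b) - stackAt i₀ (walkEmbed n b) * V‖ ≤ ε →
        A.Implements f h V ε := by
  obtain ⟨s, hq, hs⟩ := hT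
  refine ⟨{ Anc := Bool × ι, start := (false, i₀), steps := s }, hq, fun f h V ε hε => ?_⟩
  have hembed : (QueryAlgorithm.embed { Anc := Bool × ι, start := (false, i₀), steps := s }) =
      (stackAt i₀ (walkEmbed n b)).submatrix (splitIndex n b ι) id := by
    ext ⟨j, k, z, c, i⟩ l
    by_cases hi : i = i₀
    · simp [QueryAlgorithm.embed, stackAt, stack, walkEmbed, splitIndex, hi]
    · simp [QueryAlgorithm.embed, stackAt, stack, splitIndex, hi]
  have hmat : QueryAlgorithm.toMatrix { Anc := Bool × ι, start := (false, i₀), steps := s } f h =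
      (T f h).submatrix (splitIndex n b ι) (splitIndex n b ι) := hs f h
  rw [QueryAlgorithm.Implements, hmat, hembed]
  refine le_of_eq_of_le ?_ hε
  rw [← l2_opNorm_submatrix_equiv (splitIndex n b ι)]
  change ‖_‖ = _
  congr 1
  exact congrArg₂ (· - ·) (submatrix_mul_equiv _ _ _ _ _) rfl

end Realizes

/-- Simulation with `12 M` queries. -/
theorem exists_algorithm {n d b : ℕ} (dec : BitString b → ℂ) {Λ t ε : ℝ} (hΛ : 0 < Λ)
    (hd : 0 < d) (ht : 0 ≤ t) (hε : 0 ≤ ε) (M : ℕ)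
    (hM : 4 * (2⁻¹ ^ M * Real.exp (4 * (t * Λ * d))) ≤ ε ^ 2) :
    ∃ A : QueryAlgorithm n b, A.queryCount ≤ 12 * M ∧
      ∀ (H : Matrix (QIndex n) (QIndex n) ℂ) (f : QIndex n → Equiv.Perm (QIndex n))
        (h : QIndex n → QIndex n → BitString b), H.IsHermitian → maxNorm H = Λ →
        IsPositionOracle d H f → IsValueOracle dec H h → A.Implements f h (evolution H t) ε := by
  obtain ⟨N, hN, hNd, P, hPu, hP⟩ := exists_uniform_column n hd
  have hN' : (0 : ℝ) < N := by exact_mod_cast hN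
  have hNd' : (N : ℝ) ≤ d := by exact_mod_cast hNd
  set τ : ℝ := t * Λ * N with hτ
  have hτ0 : 0 ≤ τ := by positivity
  have hττ : τ ≤ t * Λ * d := mul_le_mul_of_nonneg_left hNd' (by positivity)
  set a : ℂ := -(Complex.I * (τ : ℂ)) with ha
  have hanorm : ‖a‖ = τ := by
    rw [ha, norm_neg, norm_mul, Complex.norm_I, one_mul, Complex.norm_real,
      Real.norm_of_nonneg hτ0]
  set δ : ℝ := 2⁻¹ ^ M * Real.exp (4 * (t * Λ * d)) with hδ
  have hδ0 : 0 ≤ δ := by positivity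
  obtain ⟨T, hreal, hT⟩ := exists_realizes_taylor hPu dec hΛ.le (a := a) (by simp [ha]) M
    (δ := δ) (by rw [hanorm, hδ]; gcongr)
  obtain ⟨A, hA, hA'⟩ := hreal.exists_algorithm none
  refine ⟨A, hA, ?_⟩
  intro H f h hH hHΛ hf hh
  subst hHΛ
  refine hA' f h _ _ ?_
  have hTu := hreal.conjTranspose_mul_self f h
  have hE := stackAt_isometry (none : Option (Option (Fin (2 * M))))
    (walkEmbed_isometry (n := n) (b := b))
  set E := stackAt (none : Option (Option (Fin (2 * M)))) (walkEmbed n b) with hEdef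
  set V := evolution H t with hV
  have hVV : Vᴴ * V = 1 := evolution_unitary hH t
  set X : Matrix (QIndex n) (QIndex n) ℂ := ((maxNorm H * N : ℝ) : ℂ)⁻¹ • H with hX
  have hXnorm : ‖X‖ ≤ 1 := norm_smul_hamiltonian_le hH hf hh hPu hP
  -- The factor `Λ N` in `a` undoes the normalization of the block encoding, so `exp (a • X)` is the
  -- evolution exactly.
  have haX : a • X = (-(Complex.I * (t : ℂ))) • H := by
    have h0 : ((maxNorm H * N : ℝ) : ℂ) ≠ 0 :=
      Complex.ofReal_ne_zero.2 (mul_pos hΛ hN').ne'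
    rw [hX, smul_smul]
    congr 1
    rw [ha, hτ, mul_assoc t, Complex.ofReal_mul t]
    field_simp
  set S := ∑ m ∈ Finset.range (M + 1), (a ^ m / m.factorial) • X ^ m with hS
  have hS' : S = ∑ m ∈ Finset.range (M + 1), (m.factorial⁻¹ : ℂ) • (a • X) ^ m := by
    refine Finset.sum_congr rfl fun m _ => ?_
    rw [smul_pow a X, smul_smul _ _ (X ^ m), div_eq_inv_mul]
  have hVS : ‖V - S‖ ≤ δ := by
    have h1 := norm_exp_sub_sum_le (a • X) M
    rw [← hS', haX] at h1
    refine h1.trans ((exp_sub_sum_le (norm_nonneg _) M).trans ?_)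
    rw [← haX, norm_smul, hanorm]
    have h2 : τ * ‖X‖ ≤ τ := mul_le_of_le_one_right hτ0 hXnorm
    have h3 : 2 * (τ * ‖X‖) ≤ 4 * (t * maxNorm H * d) := by linarith
    rw [hδ]
    gcongr
  set ρ : ℝ := (√(1 + 2 * δ))⁻¹ with hρ
  obtain ⟨hρ1, hρδ⟩ := one_sub_inv_sqrt_le hδ0
  have hρ0 : 0 ≤ ρ := by positivity
  have hblock : Eᴴ * (T f h * E) = (ρ : ℂ) • S := by
    obtain ⟨B, hB, hB0⟩ := hT f h
    have hTG : T f h * E = stack fun i => B i * walkEmbed n b := by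
      rw [hEdef, ← stackAt_one_mul, ← Matrix.mul_assoc, hB, stack_mul]
    rw [hTG, conjTranspose_stackAt_mul_stack]
    rw [hB0, Matrix.smul_mul, Matrix.mul_smul, Matrix.mul_assoc,
      aeval_expCos_mul (walk_mem_unitaryGroup hPu dec hΛ.le f h) (X := X), ← Matrix.mul_assoc,
      walkEmbed_isometry, Matrix.one_mul]
    rw [walk, walk_add_conjTranspose_mul walkEmbed_isometry (blockEncoding_mul_walkEmbed hh hH P f),
      conjTranspose_walkEmbed_mul_blockEncoding hh hH hP hf]
  have hleft : (T f h * E)ᴴ * (T f h * E) = 1 := by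
    rw [conjTranspose_mul, Matrix.mul_assoc, ← Matrix.mul_assoc (T f h)ᴴ, hTu,
      Matrix.one_mul, hE]
  have hright : (E * V)ᴴ * (E * V) = 1 := by
    rw [conjTranspose_mul, Matrix.mul_assoc, ← Matrix.mul_assoc Eᴴ, hE,
      Matrix.one_mul, hVV]
  have hsq := l2_opNorm_sub_sq_le_of_isometry hleft hright
  -- The defect of the overlap splits into the Taylor error and the loss `1 - ρ` from rescaling,
  -- each at most `δ`. The squared error is then at most `2 * (2 * δ)`, hence the factor `4` in
  -- `hM`.
  have hdiff : 1 - (E * V)ᴴ * (T f h * E) =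
      Vᴴ * ((ρ : ℂ) • (V - S) + ((1 - ρ : ℝ) : ℂ) • V) := by
    rw [conjTranspose_mul, Matrix.mul_assoc, hblock, Matrix.mul_add, Matrix.mul_smul,
      Matrix.mul_smul, Matrix.mul_smul, Matrix.mul_sub, hVV, smul_sub]
    push_cast
    rw [sub_smul, one_smul]
    abel
  have hVn : ‖V‖ ≤ 1 := l2_opNorm_le_one_of_isometry hVV
  have hVn' : ‖Vᴴ‖ ≤ 1 := by rwa [l2_opNorm_conjTranspose]
  have hbound : ‖1 - (E * V)ᴴ * (T f h * E)‖ ≤ 2 * δ := by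
    rw [hdiff]
    refine (l2_opNorm_mul _ _).trans ((mul_le_of_le_one_left (norm_nonneg _) hVn').trans ?_)
    refine (norm_add_le _ _).trans ?_
    rw [norm_smul, norm_smul, Complex.norm_real, Complex.norm_real, Real.norm_of_nonneg hρ0,
      Real.norm_of_nonneg hρ1]
    have h1 : ρ * ‖V - S‖ ≤ 1 * δ := mul_le_mul (by linarith) hVS (norm_nonneg _) zero_le_one
    have h2 : (1 - ρ) * ‖V‖ ≤ δ * 1 := mul_le_mul hρδ hVn (norm_nonneg _) hδ0
    linarith
  refine le_of_sq_le_sq ?_ hε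
  linarith

/-- The algorithm without steps simulates short evolutions. -/
theorem exists_trivial_algorithm {n d b : ℕ} (dec : BitString b → ℂ) {Λ t ε : ℝ} (ht : 0 ≤ t)
    (hτ : t * Λ * d ≤ 1) (hε : 2 * (t * Λ * d) ≤ ε) :
    ∃ A : QueryAlgorithm n b, A.queryCount = 0 ∧
      ∀ (H : Matrix (QIndex n) (QIndex n) ℂ) (f : QIndex n → Equiv.Perm (QIndex n))
        (h : QIndex n → QIndex n → BitString b), H.IsHermitian → maxNorm H = Λ →
        IsPositionOracle d H f → IsValueOracle dec H h → A.Implements f h (evolution H t) ε := by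
  refine ⟨{ Anc := Unit, start := (), steps := [] }, rfl, ?_⟩
  intro H f h hH hHΛ hf hh
  subst hHΛ
  set A : QueryAlgorithm n b := { Anc := Unit, start := (), steps := [] } with hA
  have hone : A.toMatrix f h = 1 := rfl
  change ‖A.toMatrix f h * A.embed - A.embed * evolution H t‖ ≤ ε
  have heq : A.toMatrix f h * A.embed - A.embed * evolution H t =
      A.embed * (1 - evolution H t) := by
    rw [hone, Matrix.one_mul, Matrix.mul_sub, Matrix.mul_one]
  rw [heq]
  exact (l2_opNorm_mul _ _).trans ((mul_le_of_le_one_left (norm_nonneg _)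
    (l2_opNorm_le_one_of_isometry (embed_isometry A))).trans
      ((norm_evolution_sub_one_le hH hf hh ht hτ).trans hε))

/-- Above `e^e` the iterated logarithm `y = log log τ` exceeds one, so `0 < log y ≤ y` and the
quotient is at least one. -/
theorem add_max_log_le_queryBound {τ : ℝ} (hτ : 0 ≤ τ) (ε : ℝ) :
    τ + max (Real.log (1 / ε)) 0 ≤ queryBound τ ε := by
  unfold queryBound
  gcongr
  split_ifs with h
  · refine le_mul_of_one_le_right hτ ?_
    have h1 : Real.exp 1 < Real.log τ := (Real.lt_log_iff_exp_lt ((Real.exp_pos _).trans h)).2 h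
    have h2 : 1 < Real.log (Real.log τ) :=
      (Real.lt_log_iff_exp_lt ((Real.exp_pos _).trans h1)).2 h1
    rw [one_le_div (Real.log_pos h2)]
    exact Real.log_le_self (by linarith)
  · rw [mul_one]

end

theorem theorem2 :
    ∃ C : ℝ, ∀ (n d b : ℕ) (dec : BitString b → ℂ) (Λ t ε : ℝ), 0 ≤ Λ → 0 ≤ t → 0 < ε →
      ∃ A : QueryAlgorithm n b,
        (A.queryCount : ℝ) ≤ C * queryBound (t * Λ * d) ε ∧
        ∀ (H : Matrix (QIndex n) (QIndex n) ℂ) (f : QIndex n → Equiv.Perm (QIndex n))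
          (h : QIndex n → QIndex n → BitString b),
          H.IsHermitian → IsSparse d H → maxNorm H = Λ →
          IsPositionOracle d H f → IsValueOracle dec H h →
          A.Implements f h (evolution H t) ε := by
  -- With `M < 8 τ + 4 L + 5` and `1 ≤ 4 (τ + L)`, the count `12 * M` is at most `12 * (28 τ + 24 L)
  -- ≤ 336 (τ + L)`.
  refine ⟨336, fun n d b dec Λ t ε hΛ ht hε => ?_⟩
  have hτ0 : 0 ≤ t * Λ * d := by positivity
  have hbound := add_max_log_le_queryBound hτ0 ε
  set L : ℝ := max (Real.log (1 / ε)) 0 with hL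
  have hL0 : 0 ≤ L := le_max_right _ _
  -- The bound can be arbitrarily small when `τ` is small and `ε` is not, so that case must cost no
  -- query at all. Otherwise `τ + L ≥ 1/4`, which absorbs the additive constant in `M`.
  by_cases htriv : t * Λ * d ≤ 1 ∧ 2 * (t * Λ * d) ≤ ε
  · obtain ⟨A, hA, hA'⟩ := exists_trivial_algorithm (n := n) dec ht htriv.1 htriv.2
    refine ⟨A, ?_, fun H f h hH _ => hA' H f h hH⟩
    rw [hA, Nat.cast_zero]
    linarith
  · have hτpos : 0 < t * Λ * d := by
      rcases hτ0.lt_or_eq with h | h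
      · exact h
      · exact absurd ⟨by linarith, by linarith⟩ htriv
    have hd : 0 < d := Nat.pos_of_ne_zero fun h => by simp [h] at hτpos
    have hΛ' : 0 < Λ := hΛ.lt_of_ne fun h => by simp [← h] at hτpos
    set τ := t * Λ * d with hτ
    have hlog2 : (1 : ℝ) / 2 < Real.log 2 := by linarith [Real.log_two_gt_d9]
    have hlow : 1 / 4 ≤ τ + L := by
      by_contra! hlt
      have h1 : ε < 1 / 2 := by
        by_contra! h
        exact htriv ⟨by linarith, by linarith⟩
      have h2 : Real.log 2 ≤ Real.log (1 / ε) :=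
        Real.log_le_log (by norm_num) (by rw [le_div_iff₀ hε]; linarith)
      have h3 : Real.log (1 / ε) ≤ L := le_max_left _ _
      linarith
    -- From `4 ≤ e²` and `log 2 > 1/2`, the requirement `4 * 2⁻ᴹ * exp (4 τ) ≤ ε²` follows from `M /
    -- 2 ≥ 4 τ + 2 L + 2`.
    set M := ⌈2 * (4 * τ + 2 * L + 2)⌉₊ with hM
    have hMlow : 2 * (4 * τ + 2 * L + 2) ≤ M := Nat.le_ceil _
    have hMup : (M : ℝ) < 2 * (4 * τ + 2 * L + 2) + 1 := Nat.ceil_lt_add_one (by positivity)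
    obtain ⟨A, hA, hA'⟩ := exists_algorithm (n := n) dec hΛ' hd ht hε.le M (by
      have h4 : (4 : ℝ) ≤ Real.exp 2 := by
        have := Real.add_one_le_exp (1 : ℝ)
        rw [show (2 : ℝ) = 1 + 1 by norm_num, Real.exp_add]
        nlinarith
      have hpow : (2⁻¹ : ℝ) ^ M = Real.exp (-(M * Real.log 2)) := by
        rw [Real.exp_neg, Real.exp_nat_mul, Real.exp_log (by norm_num), inv_pow]
      have hε2 : Real.exp (-(2 * Real.log (1 / ε))) = ε ^ 2 := by
        rw [one_div, Real.log_inv, mul_neg, neg_neg, two_mul, Real.exp_add, Real.exp_log hε, sq]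
      have hML : 1 / 2 * (M : ℝ) ≤ M * Real.log 2 := by
        rw [mul_comm]
        exact mul_le_mul_of_nonneg_left hlog2.le (Nat.cast_nonneg M)
      have h3 : Real.log (1 / ε) ≤ L := le_max_left _ _
      rw [hpow, ← hε2]
      refine (mul_le_mul_of_nonneg_right h4 (by positivity)).trans ?_
      rw [← Real.exp_add, ← Real.exp_add, Real.exp_le_exp]
      linarith)
    refine ⟨A, ?_, fun H f h hH _ => hA' H f h hH⟩
    have hA'' : (A.queryCount : ℝ) ≤ 12 * M := by exact_mod_cast hA
    linarith
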